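/- **Setting.** Let $(\Gamma,d)$ be a countable metric space that is $\nu$-regular: there are $\kappa,\nu>0$ such that every closed ball of radius $n+1$ in $\Gamma$ has at most $\kappa(n+1)^\nu$ points, for all integers $n\ge 0$. To each $x\in\Gamma$ associate a nonzero finite-dimensional complex Hilbert space $\mathcal H_x$. For finite $\Lambda\subset\Gamma$ let $\mathcal H_\Lambda=\bigotimes_{x\in\Lambda}\mathcal H_x$ and $\mathcal A_\Lambda=\mathcal B(\mathcal H_\Lambda)$ with the operator norm; for $Z\subset\Lambda$ regard $\mathcal A_Z\cong\mathcal A_Z\otimes 1$ as a subalgebra of $\mathcal A_\Lambda$, and let a linear map $\Phi$ on $\mathcal A_Z$ act on $\mathcal A_\Lambda$ as $\Phi\otimes\mathrm{id}_{\Lambda\setminus Z}$. For a linear map $\Phi$ on $\mathcal A_Z$ put $\|\Phi\|_{cb}=\sup_{n}\|\Phi\otimes \mathrm{id}_{\mathbb M_n}\|$. A dissipative interaction is a family $\mathscr L=\{L_Z\}$, indexed by the finite sets $Z\subset\Gamma$, of linear maps $L_Z:\mathcal A_Z\to\mathcal A_Z$ of Lindblad form $$L_Z(A)=i[H_Z,A]+\sum_{j=1}^{\ell_Z}\Big(K_j^*AK_j-\tfrac12\{K_j^*K_j,A\}\Big),\qquad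 H_Z=H_Z^*\in\mathcal A_Z,\ K_j\in\mathcal A_Z .$$ For finite $\Lambda$ let $\mathscr L^\Lambda=\sum_{Z\subset\Lambda}L_Z$ and $T^\Lambda_t=e^{t\mathscr L^\Lambda}$, $t\ge 0$. For $F:[0,\infty)\to(0,\infty)$ let $\|\mathscr L\|_F$ be the infimum of all $M$ with $\sum_{Z\ni x,y}\|L_Z\|_{cb}\le M\,F(d(x,y))$ for all $x,y\in\Gamma$ (sum over finite $Z$), and let $C_F$ be the infimum of all $C$ with $\sum_{z\in\Gamma}F(d(x,z))F(d(z,y))\le C\,F(d(x,y))$ for all $x,y\in\Gamma$. **Theorem.** Let $F(r)=(1+r)^{-\alpha}$ with $\alpha>2\nu+1$, and let $\mathscr L$ be a dissipative interaction with $\|\mathscr L\|_F<\infty$. Put $v=\|\mathscr L\|_F\,C_F$. Fix $\epsilon\in(0,\alpha-2\nu-1)$, set $\alpha_\epsilon=\alpha-\nu-1-\epsilon$ and $C_\epsilon=\sum_{n\ge0}(1+n)^{-(1+\epsilon)}$, and let $0<\delta<1$ satisfy $(1-\delta)\alpha_\epsilon>\nu$. Let $X,Y\subset\Gamma$ be nonempty,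 finite and disjoint, with distance $d(X,Y)=\min_{x\in X,\,y\in Y}d(x,y)$, let $\Lambda\subset\Gamma$ be finite with $X\cup Y\subset\Lambda$, let $A\in\mathcal A_X$, and let $K$ be a completely bounded linear map on $\mathcal A_Y$ with $K(1)=0$. Then there is $C>0$ for which $$\|K(T^\Lambda_t(A))\|\le C\,\|K\|_{cb}\,\|A\|\,|X|\cdot\frac{t}{(1+d(X,Y))^{(1-\delta)\alpha_\epsilon-\nu}}$$ whenever $d(X,Y)\ge1$, $t\ge 0$ and $e\,v\,t\le d(X,Y)^\delta$. Moreover, the inequality holds under the same conditions with $$C=\kappa\,C_\epsilon\,\|\mathscr L\|_F\left(e+\kappa\,2^{2\alpha_\epsilon}\,2^{1-\delta}\,\frac{C_\epsilon+C_F}{C_F}\right).$$ -/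

import Mathlib

open scoped ENNReal NNReal Matrix Matrix.Norms.L2Operator

noncomputable section

namespace LRB

/-! ### Metric notions -/

/-- `(Γ, d)` is `ν`-regular with constant `κ`: every closed ball of radius `n + 1`
has at most `κ (n + 1) ^ ν` points, for all natural numbers `n`. -/
def IsRegular (Γ : Type*) [MetricSpace Γ] (κ ν : ℝ) : Prop :=
  ∀ (x : Γ) (n : ℕ), (Metric.closedBall x ((n : ℝ) + 1)).Finite ∧
    ((Metric.closedBall x ((n : ℝ) + 1)).ncard : ℝ) ≤ κ * ((n : ℝ) + 1) ^ ν

/-- The distance `d(X, Y)` between two nonempty finite sets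
(the value is `0` when one of the sets is empty). -/
def setDist {Γ : Type*} [MetricSpace Γ] (X Y : Finset Γ) : ℝ :=
  sInf {r : ℝ | ∃ x ∈ X, ∃ y ∈ Y, r = dist x y}

/-- The power law `F(r) = 1 / (1 + r) ^ α`. -/
def powerLaw (α : ℝ) (r : ℝ) : ℝ := 1 / (1 + r) ^ α

/-- The convolution constant `C_F`: the infimum of all `C` such that
`∑ z, F(d(x,z)) F(d(z,y)) ≤ C F(d(x,y))` for all `x, y`
(it is `∞` if and only if there is no finite such `C`). -/
def convConst (Γ : Type*) [MetricSpace Γ] (F : ℝ → ℝ) : ℝ≥0∞ :=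
  sInf {C : ℝ≥0∞ | ∀ x y : Γ,
    ∑' z : Γ, ENNReal.ofReal (F (dist x z)) * ENNReal.ofReal (F (dist z y))
      ≤ C * ENNReal.ofReal (F (dist x y))}

/-! ### Linear maps on finite-dimensional normed spaces -/

/-- The operator norm of a linear map on a finite-dimensional normed space. -/
def opNorm {E : Type*} [NormedAddCommGroup E] [NormedSpace ℂ E] [FiniteDimensional ℂ E]
    (Φ : E →ₗ[ℂ] E) : ℝ≥0∞ :=
  ‖LinearMap.toContinuousLinearMap Φ‖ₑ

/-- The semigroup `exp (t Φ)` generated by a linear map `Φ` on a finite-dimensional normed space,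
the exponential being that of the Banach algebra of continuous linear maps. -/
def expFlow {E : Type*} [NormedAddCommGroup E] [NormedSpace ℂ E] [FiniteDimensional ℂ E]
    (Φ : E →ₗ[ℂ] E) (t : ℝ) : E →ₗ[ℂ] E :=
  (NormedSpace.exp ((t : ℂ) • LinearMap.toContinuousLinearMap Φ) : E →L[ℂ] E).toLinearMap

/-! ### Matrix algebras, Lindblad generators, completely bounded norm

Matrix algebras carry the operator norm of `ℂ^m` with its Hilbert space norm. -/

/-- `Φ ⊗ id` on `n × n` block matrices with entries in a matrix algebra: `Φ` acts on each block. -/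
def ampliation {m : Type*} (n : ℕ)
    (Φ : Matrix m m ℂ →ₗ[ℂ] Matrix m m ℂ) :
    Matrix (m × Fin n) (m × Fin n) ℂ →ₗ[ℂ] Matrix (m × Fin n) (m × Fin n) ℂ where
  toFun M := Matrix.of fun p q =>
    Φ (Matrix.of fun a b => M (a, p.2) (b, q.2)) p.1 q.1
  map_add' M N := by
    ext p q
    exact congrFun (congrFun (Φ.map_add (Matrix.of fun a b => M (a, p.2) (b, q.2))
      (Matrix.of fun a b => N (a, p.2) (b, q.2))) p.1) q.1
  map_smul' c M := by
    ext p q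
    exact congrFun (congrFun (Φ.map_smul c (Matrix.of fun a b => M (a, p.2) (b, q.2))) p.1) q.1

/-- The completely bounded norm `‖Φ‖_cb = sup_n ‖Φ ⊗ id_n‖`. -/
def cbNorm {m : Type*} [Fintype m] [DecidableEq m]
    (Φ : Matrix m m ℂ →ₗ[ℂ] Matrix m m ℂ) : ℝ≥0∞ :=
  ⨆ n : ℕ, opNorm (ampliation n Φ)

/-- `Φ` is of Lindblad form:
`Φ(A) = i[H, A] + ∑ j, (K_j* A K_j - ½ (K_j* K_j A + A K_j* K_j))` with `H` self-adjoint. -/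
def IsLindblad {m : Type*} [Fintype m]
    (Φ : Matrix m m ℂ →ₗ[ℂ] Matrix m m ℂ) : Prop :=
  ∃ (H : Matrix m m ℂ) (l : ℕ) (K : Fin l → Matrix m m ℂ), H.IsHermitian ∧
    ∀ A : Matrix m m ℂ, Φ A = Complex.I • (H * A - A * H) +
      ∑ j, ((K j)ᴴ * A * K j - (1 / 2 : ℂ) • ((K j)ᴴ * K j * A + A * ((K j)ᴴ * K j)))

/-- The class of completely bounded maps that annihilate the identity. -/
def IsCB0 {m : Type*} [Fintype m] [DecidableEq m]
    (Φ : Matrix m m ℂ →ₗ[ℂ] Matrix m m ℂ) : Prop :=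
  cbNorm Φ < ∞ ∧ Φ 1 = 0

/-! ### The quantum spin system

The single-site Hilbert space at `x` is `ℂ^(ι x)`, where `ι x` labels an orthonormal basis. Then
`⨂ x ∈ Λ, ℂ^(ι x)` has the orthonormal basis labelled by the configurations `Π x ∈ Λ, ι x`. -/

/-- The configurations on `Λ`, i.e. the labels of the product basis of the Hilbert space of `Λ`. -/
abbrev Config {Γ : Type*} (ι : Γ → Type*) (Λ : Finset Γ) : Type _ := ∀ x : Λ, ι x

/-- The algebra of observables on the finite volume `Λ`. -/
abbrev LocalAlg {Γ : Type*} (ι : Γ → Type*) (Λ : Finset Γ) : Type _ :=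
  Matrix (Config ι Λ) (Config ι Λ) ℂ

section Spin

variable {Γ : Type*} [DecidableEq Γ] {ι : Γ → Type*}

/-- Restriction of a configuration on `Λ` to a subset `Z`. -/
def Config.restrict {Z Λ : Finset Γ} (h : Z ⊆ Λ) (σ : Config ι Λ) : Config ι Z :=
  fun x => σ ⟨x.1, h x.2⟩

/-- The configuration on `Λ` equal to `a` on `Z` and to `σ` on `Λ \ Z`. -/
def Config.glue {Z Λ : Finset Γ} (a : Config ι Z) (σ : Config ι Λ) : Config ι Λ :=
  fun x => if hx : x.1 ∈ Z then a ⟨x.1, hx⟩ else σ x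

/-- The embedding of observables on `X` into those on `Λ`, given by `A ↦ A ⊗ 1_{Λ \ X}`. -/
def embed [∀ x, DecidableEq (ι x)] {X Λ : Finset Γ} (h : X ⊆ Λ) (A : LocalAlg ι X) :
    LocalAlg ι Λ :=
  Matrix.of fun σ τ =>
    if ∀ x : Λ, x.1 ∉ X → σ x = τ x then A (σ.restrict h) (τ.restrict h) else 0

/-- The map `Φ ⊗ id_{Λ \ Z}` on the observables on `Λ`, for a linear map `Φ` on the observables
on `Z`: `Φ` acts on each of the blocks labelled by the configurations on `Λ \ Z`. -/
def extend {Z Λ : Finset Γ} (h : Z ⊆ Λ) (Φ : LocalAlg ι Z →ₗ[ℂ] LocalAlg ι Z) :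
    LocalAlg ι Λ →ₗ[ℂ] LocalAlg ι Λ where
  toFun M := Matrix.of fun σ τ =>
    Φ (Matrix.of fun a b => M (a.glue σ) (b.glue τ)) (σ.restrict h) (τ.restrict h)
  map_add' M N := by
    ext σ τ
    exact congrFun (congrFun (Φ.map_add (Matrix.of fun a b => M (a.glue σ) (b.glue τ))
      (Matrix.of fun a b => N (a.glue σ) (b.glue τ))) (σ.restrict h)) (τ.restrict h)
  map_smul' c M := by
    ext σ τ
    exact congrFun (congrFun (Φ.map_smul c (Matrix.of fun a b => M (a.glue σ) (b.glue τ)))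
      (σ.restrict h)) (τ.restrict h)

/-- A dissipative interaction: for each finite `Z` a linear map of Lindblad form on the
observables on `Z`. -/
structure Interaction (ι : Γ → Type*) [∀ x, Fintype (ι x)] where
  /-- the local term on `Z` -/
  term : (Z : Finset Γ) → (LocalAlg ι Z →ₗ[ℂ] LocalAlg ι Z)
  lindblad : ∀ Z, IsLindblad (term Z)

variable [∀ x, Fintype (ι x)] [∀ x, DecidableEq (ι x)]

/-- The `F`-norm of an interaction: the infimum of all `M` such that
`∑_{Z ∋ x, y} ‖L_Z‖_cb ≤ M F(d(x,y))` for all `x, y` (`∞` if there is no finite such `M`). -/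
def Interaction.fNorm [MetricSpace Γ] (L : Interaction ι) (F : ℝ → ℝ) : ℝ≥0∞ :=
  sInf {M : ℝ≥0∞ | ∀ x y : Γ,
    ∑' Z : {Z : Finset Γ // x ∈ Z ∧ y ∈ Z}, cbNorm (L.term Z.1)
      ≤ M * ENNReal.ofReal (F (dist x y))}

/-- The finite-volume generator `∑_{Z ⊆ Λ} L_Z`, each `L_Z` acting as `L_Z ⊗ id`. -/
def Interaction.generator (L : Interaction ι) (Λ : Finset Γ) :
    LocalAlg ι Λ →ₗ[ℂ] LocalAlg ι Λ :=
  ∑ Z ∈ Λ.powerset.attach, extend (Finset.mem_powerset.1 Z.2) (L.term Z.1)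

/-- The finite-volume dynamics `T_t = exp (t 𝓛)`, with `𝓛` the generator of the volume `Λ`. -/
def Interaction.dynamics (L : Interaction ι) (Λ : Finset Γ) (t : ℝ) :
    LocalAlg ι Λ →ₗ[ℂ] LocalAlg ι Λ :=
  expFlow (L.generator Λ) t

end Spin

end LRB

end

/-! Split the generator at a length scale R into a short part P (sets of diameter at most R) and a
long part Q.

For P, the decay function F may be replaced by e·F(r)·exp(-r/R) without changing the convolution
constant, so the Lieb–Robinson bound carries F(r)·exp(-r/R)·(e^u - 1)/C_F with u = e·v·t. Once u ≤
d/R, the growth e^u is absorbed by exp(-r/R) for all r ≥ d, and min(u,1)·F(r)/C_F remains; the bound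
by u supplies the factor t. The choice R = d^(1-δ) gives d/R = d^δ, so u ≤ d/R is exactly the
hypothesis on t.

For Q, Duhamel's formula reduces the error to the sum over long Z of ‖L_Z(e^{sP} A)‖. Sets coming
closer than d to X are bounded trivially by contractivity; the others by the Lieb–Robinson bound for
P, applied with L_Z as the test map. Distributed over sites z, these bounds have total weight of
order |X|(1+d)^ν. The long sets through a given z cost at most the tail of F beyond R/2. That tail
is of order R^(-α_ε), since summing over a ν-regular space loses ν + 1 + ε in the exponent. The
product is t(1+d)^(ν-(1-δ)α_ε).

The Lieb–Robinson bound needs two facts: maps with disjoint supports commute (`extend_comm`), and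
every subfamily of Lindblad terms generates a contraction semigroup (`IsLindblad.quasiContractive`,
`QuasiContractive.sum`, `QuasiContractive.norm_flow_le_one`). It is obtained in
`norm_apply_flow_le_of_supersolution` by comparison with an explicit supersolution instead of
summing a series over chains of sets. The truncation argument is `norm_apply_flow_le_of_truncation`;
the powers of d are collected in `truncation_constant_le`. -/

noncomputable section

namespace LRB

/-! ### Semigroups of bounded operators -/

section Semigroup

open Filter Topology

variable {E : Type*} [NormedAddCommGroup E] [NormedSpace ℂ E]

/-- The operator semigroup `exp (t P)` generated by a bounded operator. -/
def flow (P : E →L[ℂ] E) (t : ℝ) : E →L[ℂ] E := NormedSpace.exp ((t : ℂ) • P)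

/-- `‖1 + h Φ‖ ≤ 1 + O(h²)` for small `h ≥ 0`, a form of dissipativity of a bounded operator. -/
def QuasiContractive (Φ : E →L[ℂ] E) : Prop :=
  ∃ C : ℝ, 0 ≤ C ∧ ∀ h : ℝ, 0 ≤ h → h ≤ 1 → ‖1 + (h : ℂ) • Φ‖ ≤ 1 + C * h ^ 2

theorem norm_one_le_one : ‖(1 : E →L[ℂ] E)‖ ≤ 1 := ContinuousLinearMap.norm_id_le

theorem QuasiContractive.zero : QuasiContractive (0 : E →L[ℂ] E) :=
  ⟨0, le_rfl, fun h _ _ => by simpa using norm_one_le_one⟩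

/-- The product (1 + hΦ)(1 + hΨ) differs from 1 + h(Φ + Ψ) only by h²ΦΨ. This is why the notion
allows an O(h²) error: sums of generators are covered without a product formula for semigroups. -/
theorem QuasiContractive.add {Φ Ψ : E →L[ℂ] E} (hΦ : QuasiContractive Φ)
    (hΨ : QuasiContractive Ψ) : QuasiContractive (Φ + Ψ) := by
  obtain ⟨C, hC, h1⟩ := hΦ
  obtain ⟨D, hD, h2⟩ := hΨ
  refine ⟨C + D + C * D + ‖Φ * Ψ‖, by positivity, fun h h0 hh => ?_⟩
  have key : 1 + (h : ℂ) • (Φ + Ψ)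
      = (1 + (h : ℂ) • Φ) * (1 + (h : ℂ) • Ψ) - ((h : ℂ) ^ 2) • (Φ * Ψ) := by
    simp only [mul_add, add_mul, one_mul, mul_one, smul_mul_smul_comm, smul_add, pow_two]
    abel
  rw [key]
  have e1 : ‖((h : ℂ) ^ 2) • (Φ * Ψ)‖ = h ^ 2 * ‖Φ * Ψ‖ := by
    rw [norm_smul]; simp
  have e2 := norm_mul_le (1 + (h : ℂ) • Φ) (1 + (h : ℂ) • Ψ)
  have e3 : ‖1 + (h : ℂ) • Φ‖ * ‖1 + (h : ℂ) • Ψ‖ ≤ (1 + C * h ^ 2) * (1 + D * h ^ 2) :=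
    mul_le_mul (h1 h h0 hh) (h2 h h0 hh) (norm_nonneg _) (by positivity)
  have e4 := norm_sub_le ((1 + (h : ℂ) • Φ) * (1 + (h : ℂ) • Ψ)) (((h : ℂ) ^ 2) • (Φ * Ψ))
  have e5 : h ^ 2 * h ^ 2 ≤ h ^ 2 := by
    have : h ^ 2 ≤ 1 := pow_le_one₀ h0 hh
    nlinarith [sq_nonneg h]
  have e6 := mul_le_mul_of_nonneg_left e5 (mul_nonneg hC hD)
  nlinarith

theorem QuasiContractive.sum {ι : Type*} (s : Finset ι) {Φ : ι → E →L[ℂ] E}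
    (h : ∀ i ∈ s, QuasiContractive (Φ i)) : QuasiContractive (∑ i ∈ s, Φ i) := by
  classical
  induction s using Finset.induction_on with
  | empty => simpa using QuasiContractive.zero
  | insert a s ha ih =>
    rw [Finset.sum_insert ha]
    exact (h a (by simp)).add (ih fun i hi => h i (by simp [hi]))

theorem flow_zero (P : E →L[ℂ] E) : flow P 0 = 1 := by
  simp [flow]

theorem _root_.HasDerivAt.apply_vector {f : ℝ → E →L[ℂ] E} {f' : E →L[ℂ] E} {s : ℝ}
    (h : HasDerivAt f f' s) (A : E) : HasDerivAt (fun s => f s A) (f' A) s :=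
  ((ContinuousLinearMap.apply ℂ E A).restrictScalars ℝ).hasFDerivAt.comp_hasDerivAt s h

variable [CompleteSpace E]

theorem hasDerivAt_flow (P : E →L[ℂ] E) (s : ℝ) :
    HasDerivAt (flow P) (P * flow P s) s :=
  ((hasDerivAt_exp_smul_const' P (s : ℂ)).scomp s Complex.ofRealCLM.hasDerivAt).congr_deriv
    (by simp [flow])

theorem hasDerivAt_flow' (P : E →L[ℂ] E) (s : ℝ) :
    HasDerivAt (flow P) (flow P s * P) s :=
  ((hasDerivAt_exp_smul_const P (s : ℂ)).scomp s Complex.ofRealCLM.hasDerivAt).congr_deriv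
    (by simp [flow])

theorem hasDerivAt_flow_const_sub (P : E →L[ℂ] E) (t s : ℝ) :
    HasDerivAt (fun s => flow P (t - s)) (-(flow P (t - s) * P)) s :=
  ((hasDerivAt_flow' P (t - s)).scomp s ((hasDerivAt_id s).const_sub t)).congr_deriv (by simp)

theorem flow_nat_mul (P : E →L[ℂ] E) (n : ℕ) (s : ℝ) : flow P (n * s) = flow P s ^ n := by
  let _ := NormedAlgebra.restrictScalars ℚ ℂ (E →L[ℂ] E)
  rw [flow, flow, ← NormedSpace.exp_nsmul, ← Nat.cast_smul_eq_nsmul ℂ, smul_smul]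
  simp

theorem QuasiContractive.eventually_norm_flow_le {P : E →L[ℂ] E} (hP : QuasiContractive P)
    {η : ℝ} (hη : 0 < η) : ∀ᶠ h : ℝ in 𝓝 0, 0 ≤ h → ‖flow P h‖ ≤ 1 + η * h := by
  obtain ⟨C, hC, h1⟩ := hP
  have hd := (hasDerivAt_flow P 0).isLittleO
  have h2 := hd.def (half_pos hη)
  have h3 : ∀ᶠ h : ℝ in 𝓝 0, h < 1 := gt_mem_nhds one_pos
  have h4 : ∀ᶠ h : ℝ in 𝓝 0, C * h < η / 2 := by
    have : Tendsto (fun h : ℝ => C * h) (𝓝 0) (𝓝 (C * 0)) := tendsto_id.const_mul C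
    rw [mul_zero] at this
    exact this.eventually (gt_mem_nhds (half_pos hη))
  filter_upwards [h2, h3, h4] with h h2 h3 h4 h0
  have e := h1 h h0 h3.le
  simp only [flow_zero, sub_zero, mul_one, Real.norm_eq_abs, abs_of_nonneg h0] at h2
  have e2 : flow P h = (flow P h - 1 - h • P) + (1 + (h : ℂ) • P) := by
    rw [Complex.coe_smul]; abel
  rw [e2]
  refine (norm_add_le _ _).trans ?_
  nlinarith

/-- Over a short time step h the norm is at most 1 + ηh ≤ exp(ηh); equal steps multiply to exp(ηt),
and η > 0 is arbitrary. -/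
theorem QuasiContractive.norm_flow_le_one {P : E →L[ℂ] E} (hP : QuasiContractive P)
    {t : ℝ} (ht : 0 ≤ t) : ‖flow P t‖ ≤ 1 := by
  have hexp : ∀ η : ℝ, 0 < η → ‖flow P t‖ ≤ Real.exp (η * t) := by
    intro η hη
    have hlim : Tendsto (fun n : ℕ => t / ((n : ℝ) + 1)) atTop (𝓝 0) := by
      simpa [div_eq_mul_inv] using
        (tendsto_one_div_add_atTop_nhds_zero_nat (𝕜 := ℝ)).const_mul t
    obtain ⟨n, hn⟩ := (hlim.eventually (hP.eventually_norm_flow_le hη)).exists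
    have hs : 0 ≤ t / ((n : ℝ) + 1) := by positivity
    have e : t = ((n + 1 : ℕ) : ℝ) * (t / ((n : ℝ) + 1)) := by
      push_cast; field_simp
    calc ‖flow P t‖ = ‖flow P (t / ((n : ℝ) + 1)) ^ (n + 1)‖ := by
          rw [← flow_nat_mul, ← e]
      _ ≤ ‖flow P (t / ((n : ℝ) + 1))‖ ^ (n + 1) := norm_pow_le' _ (Nat.succ_pos n)
      _ ≤ (Real.exp (η * (t / ((n : ℝ) + 1)))) ^ (n + 1) := by
          refine pow_le_pow_left₀ (norm_nonneg _) ((hn hs).trans ?_) _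
          rw [add_comm]; exact Real.add_one_le_exp _
      _ = Real.exp (η * t) := by
          rw [← Real.exp_nat_mul]; congr 1; push_cast; field_simp
  have hlim : Tendsto (fun η : ℝ => Real.exp (η * t)) (𝓝[>] 0) (𝓝 1) := by
    have : ContinuousAt (fun η : ℝ => Real.exp (η * t)) 0 := by fun_prop
    have h := this.tendsto
    simp only [zero_mul, Real.exp_zero] at h
    exact h.mono_left nhdsWithin_le_nhds
  exact ge_of_tendsto hlim (eventually_nhdsWithin_of_forall fun η hη => hexp η hη)

/-- Duhamel's estimate for a perturbation of a semigroup. -/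
theorem norm_flow_add_sub_flow_le {P Q : E →L[ℂ] E}
    (hPQ : ∀ s : ℝ, 0 ≤ s → ‖flow (P + Q) s‖ ≤ 1) (A : E) {t B : ℝ} (ht : 0 ≤ t)
    (hB : ∀ s : ℝ, 0 ≤ s → s ≤ t → ‖Q (flow P s A)‖ ≤ B) :
    ‖flow (P + Q) t A - flow P t A‖ ≤ B * t := by
  -- This path interpolates between the two dynamics, and only Q survives in its derivative.
  -- Contractivity is needed for the perturbed semigroup only.
  have hd : ∀ s : ℝ, HasDerivAt (fun s => (flow (P + Q) (t - s) * flow P s) A)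
      (-(flow (P + Q) (t - s) (Q (flow P s A)))) s := by
    intro s
    refine (((hasDerivAt_flow_const_sub (P + Q) t s).mul (hasDerivAt_flow P s)).apply_vector
      A).congr_deriv ?_
    simp
  have h := norm_image_sub_le_of_norm_deriv_right_le_segment (C := B) (a := 0) (b := t)
    (fun s _ => (hd s).continuousAt.continuousWithinAt)
    (fun s _ => (hd s).hasDerivWithinAt) (fun s hs => by
      rw [norm_neg]
      refine (ContinuousLinearMap.le_of_opNorm_le _ (hPQ _ (by linarith [hs.2])) _).trans ?_
      rw [one_mul]
      exact hB s hs.1 hs.2.le) t ⟨ht, le_rfl⟩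
  simpa [flow_zero, norm_sub_rev] using h

end Semigroup

/-! ### The iteration behind Lieb–Robinson bounds -/

section Iteration

variable {Γ : Type*} [DecidableEq Γ] {E : Type*} [NormedAddCommGroup E] [NormedSpace ℂ E]
  [CompleteSpace E]

/-- The one-step estimate: a bound on the propagation to the sets `Z` met by the generator
yields one on the propagation to `Y`. -/
theorem norm_apply_flow_le_of_step (S : Finset (Finset Γ)) (l : Finset Γ → E →L[ℂ] E)
    (hcontr : ∀ S' ⊆ S, ∀ t : ℝ, 0 ≤ t → ‖flow (∑ Z ∈ S', l Z) t‖ ≤ 1)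
    (A : E) (Y : Finset Γ) (k : E →L[ℂ] E) {c : ℝ} (hc : ‖k‖ ≤ c)
    (hcomm : ∀ Z ∈ S, Disjoint Z Y → Commute (l Z) k)
    (b : Finset Γ → ℝ → ℝ) (B B' : ℝ → ℝ) (hB : ∀ s, HasDerivAt B (B' s) s)
    (hA : ‖k A‖ ≤ c * B 0)
    (hl : ∀ Z ∈ S, ¬ Disjoint Z Y → ∀ s : ℝ, 0 ≤ s →
      ‖l Z (flow (∑ Z ∈ S, l Z) s A)‖ ≤ b Z s)
    (hb : ∀ s : ℝ, 0 ≤ s → ∑ Z ∈ S with ¬ Disjoint Z Y, b Z s ≤ B' s)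
    {t : ℝ} (ht : 0 ≤ t) : ‖k (flow (∑ Z ∈ S, l Z) t A)‖ ≤ c * B t := by
  set P := ∑ Z ∈ S, l Z with hP
  set P₀ := ∑ Z ∈ S with Disjoint Z Y, l Z with hP₀
  have hc0 : 0 ≤ c := (norm_nonneg k).trans hc
  have hsplit : P₀ + ∑ Z ∈ S with ¬ Disjoint Z Y, l Z = P :=
    Finset.sum_filter_add_sum_filter_not S (fun Z => Disjoint Z Y) l
  have hk : P₀ * k = k * P₀ := by
    refine (Commute.sum_left _ _ _ fun Z hZ => ?_ : Commute P₀ k)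
    exact hcomm Z (Finset.mem_filter.1 hZ).1 (Finset.mem_filter.1 hZ).2
  -- The generator P₀ of the terms away from Y commutes with k, so evolving backwards with P₀
  -- removes these terms from the derivative: only sets meeting Y remain.
  have hd : ∀ s : ℝ, HasDerivAt (fun s => (flow P₀ (t - s) * (k * flow P s)) A)
      (flow P₀ (t - s) (k ((∑ Z ∈ S with ¬ Disjoint Z Y, l Z) (flow P s A)))) s := by
    intro s
    refine (((hasDerivAt_flow_const_sub P₀ t s).mul
      ((hasDerivAt_flow P s).const_mul k)).apply_vector A).congr_deriv ?_
    have e : -(flow P₀ (t - s) * P₀) * (k * flow P s) + flow P₀ (t - s) * (k * (P * flow P s))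
        = flow P₀ (t - s) * (k * ((∑ Z ∈ S with ¬ Disjoint Z Y, l Z) * flow P s)) := by
      rw [← hsplit]
      have : -(flow P₀ (t - s) * P₀) * (k * flow P s)
          = - (flow P₀ (t - s) * (k * (P₀ * flow P s))) := by
        rw [neg_mul, mul_assoc, ← mul_assoc P₀, hk, mul_assoc k]
      rw [hsplit, this, ← hsplit, add_mul, mul_add, mul_add, hsplit]
      abel
    rw [e]
    rfl
  have h0 : ∀ S' ⊆ S, ∀ (s : ℝ), 0 ≤ s → ∀ v : E, ‖flow (∑ Z ∈ S', l Z) s v‖ ≤ ‖v‖ := by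
    intro S' hS' s hs v
    simpa using ContinuousLinearMap.le_of_opNorm_le _ (hcontr S' hS' s hs) v
  have h := image_norm_le_of_norm_deriv_right_le_deriv_boundary (a := 0) (b := t)
    (B := fun s => c * B s) (B' := fun s => c * B' s)
    (fun s _ => (hd s).continuousAt.continuousWithinAt)
    (fun s _ => (hd s).hasDerivWithinAt) ?_ (fun s => (hB s).const_mul c) ?_
    (x := t) ⟨ht, le_rfl⟩
  · simpa [flow_zero] using h
  · simp only [flow_zero, sub_zero, mul_one, mul_apply_eq_comp]
    exact (h0 _ (Finset.filter_subset _ _) t ht _).trans hA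
  · intro s hs
    refine (h0 _ (Finset.filter_subset _ _) (t - s) (by linarith [hs.2]) _).trans ?_
    refine (ContinuousLinearMap.le_of_opNorm_le _ hc _).trans ?_
    refine mul_le_mul_of_nonneg_left ?_ hc0
    rw [sum_apply]
    refine (norm_sum_le _ _).trans ((Finset.sum_le_sum fun Z hZ => ?_).trans (hb s hs.1))
    exact hl Z (Finset.mem_filter.1 hZ).1 (Finset.mem_filter.1 hZ).2 s hs.1

/-- A supersolution `U` of the Lieb–Robinson iteration bounds the propagation of `A`. -/
theorem norm_apply_flow_le_of_supersolution (S : Finset (Finset Γ)) (l : Finset Γ → E →L[ℂ] E)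
    (w : Finset Γ → ℝ) (hw : ∀ Z, 0 ≤ w Z) (hl : ∀ Z ∈ S, Z.Nonempty → ‖l Z‖ ≤ w Z)
    (hcontr : ∀ S' ⊆ S, ∀ t : ℝ, 0 ≤ t → ‖flow (∑ Z ∈ S', l Z) t‖ ≤ 1)
    (hcomm : ∀ Z ∈ S, ∀ Z' ∈ S, Disjoint Z Z' → Commute (l Z) (l Z'))
    (X : Finset Γ) (A : E) (hA : ∀ Z ∈ S, Disjoint X Z → l Z A = 0)
    (U U' : Finset Γ → ℝ → ℝ) (hU : ∀ Y s, HasDerivAt (U Y) (U' Y s) s)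
    (hU0 : ∀ Y, 0 ≤ U Y 0) (hUX : ∀ Y, ¬ Disjoint X Y → 1 ≤ U Y 0)
    (hU' : ∀ Y, ∀ s : ℝ, 0 ≤ s → ∑ Z ∈ S with ¬ Disjoint Z Y, w Z * U Z s ≤ U' Y s)
    (hUn : ∀ Y, ∀ s : ℝ, 0 ≤ s → 0 ≤ U Y s)
    (Y : Finset Γ) (k : E →L[ℂ] E) {c : ℝ} (hc : ‖k‖ ≤ c)
    (hkcomm : ∀ Z ∈ S, Disjoint Z Y → Commute (l Z) k) (hkA : Disjoint X Y → k A = 0)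
    {t : ℝ} (ht : 0 ≤ t) :
    ‖k (flow (∑ Z ∈ S, l Z) t A)‖ ≤ c * (‖A‖ * U Y t) := by
  set W := ∑ Z ∈ S, w Z with hW
  have hW0 : 0 ≤ W := Finset.sum_nonneg fun Z _ => hw Z
  -- The trivial contractive bound is the case n = 0. Each application of the one-step estimate
  -- integrates the error once, up to the total weight W, and reproduces U by the supersolution
  -- inequality. Y and k must be general because the induction hypothesis is used with the local
  -- terms `l Z` as test maps.
  have main : ∀ (n : ℕ) (Y : Finset Γ) (k : E →L[ℂ] E) (c : ℝ), ‖k‖ ≤ c →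
      (∀ Z ∈ S, Disjoint Z Y → Commute (l Z) k) → (Disjoint X Y → k A = 0) →
      ∀ t : ℝ, 0 ≤ t → ‖k (flow (∑ Z ∈ S, l Z) t A)‖
        ≤ c * (‖A‖ * (U Y t + (W * t) ^ n / n.factorial)) := by
    intro n
    induction n with
    | zero =>
      intro Y k c hc _ _ t ht
      have hc0 : 0 ≤ c := (norm_nonneg k).trans hc
      refine (ContinuousLinearMap.le_of_opNorm_le _ hc _).trans
        (mul_le_mul_of_nonneg_left ?_ hc0)
      refine (ContinuousLinearMap.le_of_opNorm_le _ (hcontr S subset_rfl t ht) _).trans ?_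
      have := mul_nonneg (norm_nonneg A) (hUn Y t ht)
      simp only [pow_zero, Nat.factorial_zero, Nat.cast_one, div_one]
      linarith
    | succ n ih =>
      intro Y k c hc hkc hkA t ht
      have hc0 : 0 ≤ c := (norm_nonneg k).trans hc
      refine norm_apply_flow_le_of_step S l hcontr A Y k hc hkc
        (fun Z s => w Z * (‖A‖ * (U Z s + (W * s) ^ n / n.factorial)))
        (fun s => ‖A‖ * (U Y s + (W * s) ^ (n + 1) / (n + 1).factorial))
        (fun s => ‖A‖ * (U' Y s + W * ((W * s) ^ n / n.factorial))) ?_ ?_ ?_ ?_ ht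
      · intro s
        refine ((hU Y s).add ?_).const_mul _
        have h1 : HasDerivAt (fun s : ℝ => W * s) W s := by
          simpa using (hasDerivAt_id s).const_mul W
        refine ((h1.pow (n + 1)).div_const _).congr_deriv ?_
        rw [Nat.factorial_succ]
        have : (n.factorial : ℝ) ≠ 0 := by positivity
        push_cast
        field_simp
      · simp only [mul_zero, ne_eq, Nat.add_eq_zero_iff, one_ne_zero, and_false,
          not_false_eq_true, zero_pow, zero_div, add_zero]
        by_cases h : Disjoint X Y
        · rw [hkA h, norm_zero]
          exact mul_nonneg hc0 (mul_nonneg (norm_nonneg _) (hU0 Y))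
        · refine (ContinuousLinearMap.le_of_opNorm_le _ hc _).trans
            (mul_le_mul_of_nonneg_left ?_ hc0)
          exact le_mul_of_one_le_right (norm_nonneg _) (hUX Y h)
      · intro Z hZ hZY s hs
        -- The norm of the term on the empty set is not controlled, but the empty set meets no Y.
        have hne : Z.Nonempty := by
          rw [Finset.nonempty_iff_ne_empty]
          rintro rfl
          simp at hZY
        exact ih Z (l Z) (w Z) (hl Z hZ hne) (fun Z' hZ' hd => hcomm Z' hZ' Z hZ hd)
          (hA Z hZ) s hs
      · intro s hs
        have e : ∀ Z, w Z * (‖A‖ * (U Z s + (W * s) ^ n / n.factorial))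
            = ‖A‖ * (w Z * U Z s + w Z * ((W * s) ^ n / n.factorial)) := fun Z => by ring
        simp only [e]
        rw [← Finset.mul_sum, Finset.sum_add_distrib, ← Finset.sum_mul]
        refine mul_le_mul_of_nonneg_left (add_le_add (hU' Y s hs) ?_) (norm_nonneg _)
        refine mul_le_mul_of_nonneg_right ?_ (by positivity)
        exact Finset.sum_le_sum_of_subset_of_nonneg (Finset.filter_subset _ _)
          fun Z _ _ => hw Z
  have hlim := FloorSemiring.tendsto_pow_div_factorial_atTop (W * t)
  have hlim' := (((hlim.const_add (U Y t)).const_mul ‖A‖).const_mul c)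
  rw [add_zero] at hlim'
  exact ge_of_tendsto' hlim' fun n => main n Y k c hc hkcomm hkA t ht

end Iteration

/-! ### Norms in matrix algebras -/

section MatrixNorm

variable {m n : Type*} [Fintype m] [DecidableEq m] [Fintype n] [DecidableEq n]

/-- Relabelling a basis is a *-homomorphism of C*-algebras, hence norm-decreasing. -/
theorem norm_reindex_le (e : m ≃ n) (M : Matrix m m ℂ) : ‖Matrix.reindex e e M‖ ≤ ‖M‖ := by
  let φ : Matrix m m ℂ →⋆ₐ[ℂ] Matrix n n ℂ :=
    { (Matrix.reindexAlgEquiv ℂ ℂ e : Matrix m m ℂ →ₐ[ℂ] Matrix n n ℂ) with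
      map_star' := fun M => by
        simp [Matrix.star_eq_conjTranspose, Matrix.conjTranspose_submatrix] }
  exact NonUnitalStarAlgHom.norm_apply_le φ M

theorem norm_reindex (e : m ≃ n) (M : Matrix m m ℂ) : ‖Matrix.reindex e e M‖ = ‖M‖ := by
  refine (norm_reindex_le e M).antisymm ?_
  simpa using norm_reindex_le e.symm (Matrix.reindex e e M)

theorem norm_blockDiagonal_const_le (A : Matrix m m ℂ) :
    ‖Matrix.blockDiagonal fun _ : n => A‖ ≤ ‖A‖ := by
  let φ : Matrix m m ℂ →⋆ₐ[ℂ] Matrix (m × n) (m × n) ℂ :=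
    { toFun := fun A => Matrix.blockDiagonal fun _ : n => A
      map_one' := Matrix.blockDiagonal_one
      map_mul' := fun A B => Matrix.blockDiagonal_mul (fun _ => A) (fun _ => B)
      map_zero' := Matrix.blockDiagonal_zero
      map_add' := fun A B => Matrix.blockDiagonal_add (fun _ => A) (fun _ => B)
      commutes' := fun c => by
        rw [Algebra.algebraMap_eq_smul_one, Algebra.algebraMap_eq_smul_one]
        exact (Matrix.blockDiagonal_smul c fun _ => (1 : Matrix m m ℂ)).trans
          (congrArg _ Matrix.blockDiagonal_one)
      map_star' := fun A => (Matrix.blockDiagonal_conjTranspose fun _ => A).symm }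
  exact NonUnitalStarAlgHom.norm_apply_le φ A

/-- Stack the W_j into one column V. The sum is V*(A ⊗ 1)V, and the C*-identity turns ‖V‖² into
‖V*V‖. This replaces an appeal to general theory of completely positive maps. -/
theorem norm_sum_conjTranspose_mul_mul_le {J : Type*} [Fintype J] [DecidableEq J]
    (W : J → Matrix m m ℂ) (A : Matrix m m ℂ) :
    ‖∑ j, (W j)ᴴ * A * W j‖ ≤ ‖A‖ * ‖∑ j, (W j)ᴴ * W j‖ := by
  let V : Matrix (m × J) m ℂ := Matrix.of fun p b => W p.2 p.1 b
  have hV : ∀ B : Matrix m m ℂ,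
      Vᴴ * (Matrix.blockDiagonal fun _ : J => B) * V = ∑ j, (W j)ᴴ * B * W j := by
    intro B
    ext a b
    simp only [Matrix.mul_apply, Matrix.sum_apply, Fintype.sum_prod_type,
      Matrix.blockDiagonal_apply, Matrix.conjTranspose_apply, Matrix.of_apply, V, mul_ite,
      mul_zero, Finset.sum_ite_eq', Finset.mem_univ, if_true]
    rw [Finset.sum_comm]
  have hV1 : Vᴴ * V = ∑ j, (W j)ᴴ * W j := by
    have := hV 1
    rw [show (Matrix.blockDiagonal fun _ : J => (1 : Matrix m m ℂ)) = 1 from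
      Matrix.blockDiagonal_one] at this
    simpa using this
  rw [← hV A, ← hV1, Matrix.l2_opNorm_conjTranspose_mul_self]
  calc ‖Vᴴ * (Matrix.blockDiagonal fun _ : J => A) * V‖
      ≤ ‖Vᴴ * (Matrix.blockDiagonal fun _ : J => A)‖ * ‖V‖ := Matrix.l2_opNorm_mul _ _
    _ ≤ ‖Vᴴ‖ * ‖Matrix.blockDiagonal fun _ : J => A‖ * ‖V‖ :=
        mul_le_mul_of_nonneg_right (Matrix.l2_opNorm_mul _ _) (norm_nonneg _)
    _ ≤ ‖V‖ * ‖A‖ * ‖V‖ := by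
        rw [Matrix.l2_opNorm_conjTranspose]
        gcongr
        exact norm_blockDiagonal_const_le A
    _ = ‖A‖ * (‖V‖ * ‖V‖) := by ring

theorem IsLindblad.map_one {Φ : Matrix m m ℂ →ₗ[ℂ] Matrix m m ℂ} (h : IsLindblad Φ) :
    Φ 1 = 0 := by
  obtain ⟨H, l, K, -, hΦ⟩ := h
  rw [hΦ]
  simp only [mul_one, one_mul, sub_self, smul_zero, zero_add]
  refine Finset.sum_eq_zero fun j _ => ?_
  rw [← two_smul ℂ ((K j)ᴴ * K j), smul_smul]
  norm_num

/-- With G = -iH - ½∑K_j*K_j the generator is A ↦ G*A + AG + ∑K_j*AK_j. Hence 1 + hΦ agrees up to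
the term h²G*AG with the completely positive map having Kraus operators 1 + hG and √h·K_j. -/
theorem IsLindblad.quasiContractive {Φ : Matrix m m ℂ →ₗ[ℂ] Matrix m m ℂ}
    (h : IsLindblad Φ) : QuasiContractive (LinearMap.toContinuousLinearMap Φ) := by
  have hΦ1 := h.map_one
  obtain ⟨H, l, K, hH, hΦ⟩ := h
  set G : Matrix m m ℂ := -(Complex.I • H) - (1 / 2 : ℂ) • ∑ j, (K j)ᴴ * K j with hG
  have hGstar : Gᴴ = Complex.I • H - (1 / 2 : ℂ) • ∑ j, (K j)ᴴ * K j := by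
    rw [hG]
    simp [Matrix.conjTranspose_sub, Matrix.conjTranspose_smul, Matrix.conjTranspose_sum,
      Matrix.conjTranspose_mul, hH.eq]
  have hΦG : ∀ A, Φ A = Gᴴ * A + A * G + ∑ j, (K j)ᴴ * A * K j := by
    intro A
    rw [hΦ, hGstar, hG]
    simp only [Finset.sum_sub_distrib, ← Finset.smul_sum, Finset.sum_add_distrib,
      ← Finset.sum_mul, ← Finset.mul_sum, sub_mul, mul_sub, smul_mul_assoc, mul_smul_comm,
      smul_add, smul_sub, mul_neg]
    abel
  refine ⟨2 * ‖G‖ ^ 2, by positivity, fun h h0 _ => ?_⟩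
  refine ContinuousLinearMap.opNorm_le_bound _ (by positivity) fun A => ?_
  let W : Option (Fin l) → Matrix m m ℂ := fun o =>
    o.elim (1 + (h : ℂ) • G) fun j => ((√h : ℝ) : ℂ) • K j
  have hsq : ((√h : ℝ) : ℂ) * ((√h : ℝ) : ℂ) = (h : ℂ) := by
    rw [← Complex.ofReal_mul, Real.mul_self_sqrt h0]
  have hW : ∀ B : Matrix m m ℂ,
      ∑ o, (W o)ᴴ * B * W o = B + (h : ℂ) • Φ B + ((h : ℂ) ^ 2) • (Gᴴ * B * G) := by
    intro B
    rw [Fintype.sum_option, hΦG]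
    simp only [W, Option.elim, Matrix.conjTranspose_add, Matrix.conjTranspose_smul,
      Matrix.conjTranspose_one, Complex.star_def, Complex.conj_ofReal, smul_mul_assoc,
      mul_smul_comm, smul_smul, hsq, add_mul, mul_add, one_mul, mul_one, smul_add,
      ← Finset.smul_sum, pow_two]
    abel
  -- Since Φ(1) = 0, there is no first-order term in h.
  have hW1 : ∑ o, (W o)ᴴ * W o = 1 + ((h : ℂ) ^ 2) • (Gᴴ * G) := by
    simpa [hΦ1] using hW 1
  have hGG : ∀ B : Matrix m m ℂ, ‖((h : ℂ) ^ 2) • (Gᴴ * B * G)‖ ≤ h ^ 2 * ‖G‖ ^ 2 * ‖B‖ := by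
    intro B
    rw [norm_smul]
    have h1 := norm_mul_le (Gᴴ * B) G
    have h2 := norm_mul_le Gᴴ B
    rw [Matrix.l2_opNorm_conjTranspose] at h2
    have h3 := mul_le_mul_of_nonneg_right h2 (norm_nonneg G)
    have e : ‖(h : ℂ) ^ 2‖ = h ^ 2 := by simp
    rw [e]
    have := mul_le_mul_of_nonneg_left (h1.trans h3) (sq_nonneg h)
    linarith
  have hone : ‖(1 : Matrix m m ℂ)‖ ≤ 1 := by
    rw [← Matrix.diagonal_one, Matrix.l2_opNorm_diagonal]
    exact (pi_norm_le_iff_of_nonneg zero_le_one).2 fun _ => by simp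
  have hS : ‖∑ o, (W o)ᴴ * W o‖ ≤ 1 + h ^ 2 * ‖G‖ ^ 2 := by
    rw [hW1]
    refine (norm_add_le _ _).trans (add_le_add hone ?_)
    have := hGG 1
    rw [mul_one] at this
    refine this.trans ?_
    exact mul_le_of_le_one_right (by positivity) hone
  have hfin : (1 + (h : ℂ) • LinearMap.toContinuousLinearMap Φ) A
      = ∑ o, (W o)ᴴ * A * W o - ((h : ℂ) ^ 2) • (Gᴴ * A * G) := by
    rw [hW A, add_sub_cancel_right]
    rfl
  rw [hfin]
  refine (norm_sub_le _ _).trans ?_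
  have h1 := norm_sum_conjTranspose_mul_mul_le W A
  have h2 := mul_le_mul_of_nonneg_left hS (norm_nonneg A)
  have h3 := hGG A
  nlinarith

theorem norm_ampliation_le {Φ : Matrix m m ℂ →ₗ[ℂ] Matrix m m ℂ} (hΦ : cbNorm Φ < ∞) (k : ℕ)
    (M : Matrix (m × Fin k) (m × Fin k) ℂ) :
    ‖ampliation k Φ M‖ ≤ (cbNorm Φ).toReal * ‖M‖ := by
  have h1 : opNorm (ampliation k Φ) ≤ cbNorm Φ := le_iSup (fun k => opNorm (ampliation k Φ)) k
  have h2 := ENNReal.toReal_mono hΦ.ne h1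
  rw [opNorm, toReal_enorm] at h2
  exact ContinuousLinearMap.le_of_opNorm_le _ h2 M

end MatrixNorm

/-! ### Local observables and local maps -/

section Local

variable {Γ : Type*} [DecidableEq Γ] {ι : Γ → Type*}

theorem Config.glue_of_mem {Z Λ : Finset Γ} (a : Config ι Z) (σ : Config ι Λ) {x : Λ}
    (hx : x.1 ∈ Z) : a.glue σ x = a ⟨x.1, hx⟩ := dif_pos hx

theorem Config.glue_of_notMem {Z Λ : Finset Γ} (a : Config ι Z) (σ : Config ι Λ) {x : Λ}
    (hx : x.1 ∉ Z) : a.glue σ x = σ x := dif_neg hx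

theorem Config.restrict_glue {Z Λ : Finset Γ} (h : Z ⊆ Λ) (a : Config ι Z) (σ : Config ι Λ) :
    (a.glue σ).restrict h = a := by
  ext x
  exact Config.glue_of_mem a σ (x := ⟨x.1, h x.2⟩) x.2

theorem Config.glue_restrict {Z Λ : Finset Γ} (h : Z ⊆ Λ) (σ : Config ι Λ) :
    (σ.restrict h).glue σ = σ := by
  ext x
  by_cases hx : x.1 ∈ Z
  · rw [Config.glue_of_mem _ _ hx]; rfl
  · rw [Config.glue_of_notMem _ _ hx]

theorem Config.restrict_glue_of_disjoint {Z Z' Λ : Finset Γ} (hd : Disjoint Z Z')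
    (h : Z' ⊆ Λ) (a : Config ι Z) (σ : Config ι Λ) :
    (a.glue σ).restrict h = σ.restrict h := by
  ext x
  exact Config.glue_of_notMem a σ (x := ⟨x.1, h x.2⟩)
    fun hx => Finset.disjoint_left.1 hd hx x.2

theorem Config.glue_glue_comm {Z Z' Λ : Finset Γ} (hd : Disjoint Z Z')
    (a : Config ι Z) (b : Config ι Z') (σ : Config ι Λ) :
    a.glue (b.glue σ) = b.glue (a.glue σ) := by
  ext x
  by_cases hx : x.1 ∈ Z
  · have hx' : x.1 ∉ Z' := Finset.disjoint_left.1 hd hx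
    rw [Config.glue_of_mem _ _ hx, Config.glue_of_notMem _ _ hx', Config.glue_of_mem _ _ hx]
  · by_cases hx' : x.1 ∈ Z'
    · rw [Config.glue_of_notMem _ _ hx, Config.glue_of_mem _ _ hx', Config.glue_of_mem _ _ hx']
    · rw [Config.glue_of_notMem _ _ hx, Config.glue_of_notMem _ _ hx',
        Config.glue_of_notMem _ _ hx', Config.glue_of_notMem _ _ hx]

/-- The block of an observable on `Λ` labelled by the values of two configurations
outside `Z`. -/
def block {Λ : Finset Γ} (Z : Finset Γ) (σ τ : Config ι Λ) : LocalAlg ι Λ →ₗ[ℂ] LocalAlg ι Z where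
  toFun M := Matrix.of fun a b => M (a.glue σ) (b.glue τ)
  map_add' _ _ := rfl
  map_smul' _ _ := rfl

theorem block_apply_restrict {Z Λ : Finset Γ} (h : Z ⊆ Λ) (σ τ : Config ι Λ)
    (M : LocalAlg ι Λ) : block Z σ τ M (σ.restrict h) (τ.restrict h) = M σ τ := by
  change M ((σ.restrict h).glue σ) ((τ.restrict h).glue τ) = M σ τ
  rw [Config.glue_restrict, Config.glue_restrict]

theorem extend_apply {Z Λ : Finset Γ} (h : Z ⊆ Λ) (Φ : LocalAlg ι Z →ₗ[ℂ] LocalAlg ι Z)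
    (M : LocalAlg ι Λ) (σ τ : Config ι Λ) :
    extend h Φ M σ τ = Φ (block Z σ τ M) (σ.restrict h) (τ.restrict h) := rfl

theorem block_conjTranspose {X Λ : Finset Γ} (M : LocalAlg ι Λ) (σ τ : Config ι Λ) :
    block X σ τ Mᴴ = (block X τ σ M)ᴴ := rfl

variable [∀ x, DecidableEq (ι x)]

theorem embed_conjTranspose {X Λ : Finset Γ} (h : X ⊆ Λ) (A : LocalAlg ι X) :
    (embed h A)ᴴ = embed h Aᴴ := by
  ext σ τ
  simp only [embed, Matrix.conjTranspose_apply, Matrix.of_apply]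
  rw [apply_ite star, star_zero]
  exact if_congr (forall_congr' fun x => imp_congr_right fun _ => eq_comm) rfl rfl

theorem embed_one {X Λ : Finset Γ} (h : X ⊆ Λ) :
    embed h (1 : LocalAlg ι X) = (1 : LocalAlg ι Λ) := by
  ext σ τ
  simp only [embed, Matrix.of_apply, Matrix.one_apply]
  by_cases hst : σ = τ
  · subst hst; simp
  · rw [if_neg hst, ite_eq_right_iff]
    intro h1
    refine if_neg fun h2 => hst ?_
    ext x
    by_cases hx : x.1 ∈ X
    · exact congrFun h2 ⟨x.1, hx⟩
    · exact h1 x hx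

/-- Relative to Y, every block of A ⊗ 1 is a scalar multiple of the identity, which Φ annihilates.
-/
theorem extend_embed_eq_zero {X Y Λ : Finset Γ} (hX : X ⊆ Λ) (hY : Y ⊆ Λ) (hd : Disjoint X Y)
    {Φ : LocalAlg ι Y →ₗ[ℂ] LocalAlg ι Y} (hΦ : Φ 1 = 0) (A : LocalAlg ι X) :
    extend hY Φ (embed hX A) = 0 := by
  ext σ τ
  have e : ∃ c : ℂ, block Y σ τ (embed hX A) = c • 1 := by
    refine ⟨if ∀ x : Λ, x.1 ∉ X → x.1 ∉ Y → σ x = τ x then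
      A (σ.restrict hX) (τ.restrict hX) else 0, ?_⟩
    ext a b
    change embed hX A (a.glue σ) (b.glue τ) = _
    simp only [embed, Matrix.of_apply, Config.restrict_glue_of_disjoint hd.symm,
      Matrix.smul_apply, Matrix.one_apply, smul_eq_mul, mul_ite, mul_one, mul_zero]
    by_cases hab : a = b
    · subst hab
      rw [if_pos rfl]
      refine if_congr (forall_congr' fun x => imp_congr_right fun _ => ?_) rfl rfl
      by_cases hx : x.1 ∈ Y
      · simp [Config.glue_of_mem _ _ hx, hx]
      · simp [Config.glue_of_notMem _ _ hx, hx]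
    · rw [if_neg hab, if_neg]
      intro h
      apply hab
      ext y
      have := h ⟨y.1, hY y.2⟩ (Finset.disjoint_right.1 hd y.2)
      rwa [Config.glue_of_mem a σ (x := ⟨y.1, hY y.2⟩) y.2,
        Config.glue_of_mem b τ (x := ⟨y.1, hY y.2⟩) y.2] at this
  obtain ⟨c, hc⟩ := e
  rw [extend_apply, hc, map_smul, hΦ]
  simp

variable [∀ x, Fintype (ι x)]

theorem embed_mul_apply {X Λ : Finset Γ} (h : X ⊆ Λ) (A : LocalAlg ι X) (M : LocalAlg ι Λ)
    (σ τ : Config ι Λ) :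
    (embed h A * M) σ τ = ∑ b, A (σ.restrict h) b * M (b.glue σ) τ := by
  rw [Matrix.mul_apply]
  simp only [embed, Matrix.of_apply, ite_mul, zero_mul]
  rw [← Finset.sum_filter]
  refine Finset.sum_bij' (fun ρ _ => ρ.restrict h) (fun b _ => b.glue σ) ?_ ?_ ?_ ?_ ?_
  · simp
  · intro b _
    simp only [Finset.mem_filter, Finset.mem_univ, true_and]
    exact fun x hx => (Config.glue_of_notMem b σ hx).symm
  · intro ρ hρ
    simp only [Finset.mem_filter, Finset.mem_univ, true_and] at hρ
    ext x
    by_cases hx : x.1 ∈ X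
    · rw [Config.glue_of_mem _ _ hx]; rfl
    · rw [Config.glue_of_notMem _ _ hx]; exact hρ x hx
  · intro b _
    exact Config.restrict_glue h b σ
  · intro ρ hρ
    simp only [Finset.mem_filter, Finset.mem_univ, true_and] at hρ
    congr 2
    ext x
    by_cases hx : x.1 ∈ X
    · rw [Config.glue_of_mem _ _ hx]; rfl
    · rw [Config.glue_of_notMem _ _ hx]; exact (hρ x hx).symm

/-- Together with its right-handed version, this makes taking blocks a bimodule map over the local
algebra. Multiplicativity of the embedding and the Lindblad form of extended maps follow from it. -/
theorem block_embed_mul {X Λ : Finset Γ} (h : X ⊆ Λ) (A : LocalAlg ι X) (M : LocalAlg ι Λ)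
    (σ τ : Config ι Λ) : block X σ τ (embed h A * M) = A * block X σ τ M := by
  ext a b
  change (embed h A * M) (a.glue σ) (b.glue τ) = _
  rw [embed_mul_apply, Matrix.mul_apply]
  refine Finset.sum_congr rfl fun c _ => ?_
  rw [Config.restrict_glue]
  change _ = A a c * M (c.glue σ) (b.glue τ)
  congr 2
  ext x
  by_cases hx : x.1 ∈ X
  · rw [Config.glue_of_mem _ _ hx, Config.glue_of_mem _ _ hx]
  · rw [Config.glue_of_notMem _ _ hx, Config.glue_of_notMem _ _ hx,
      Config.glue_of_notMem _ _ hx]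

theorem block_mul_embed {X Λ : Finset Γ} (h : X ⊆ Λ) (A : LocalAlg ι X) (M : LocalAlg ι Λ)
    (σ τ : Config ι Λ) : block X σ τ (M * embed h A) = block X σ τ M * A := by
  have h1 := congrArg Matrix.conjTranspose (block_embed_mul h Aᴴ Mᴴ τ σ)
  rw [← block_conjTranspose, Matrix.conjTranspose_mul, Matrix.conjTranspose_mul,
    ← block_conjTranspose, embed_conjTranspose] at h1
  simpa using h1

theorem embed_mul {X Λ : Finset Γ} (h : X ⊆ Λ) (A B : LocalAlg ι X) :
    embed h (A * B) = embed h A * embed h B := by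
  ext σ τ
  have h1 := block_embed_mul h (A * B) 1 σ τ
  have h2 := block_embed_mul h A (embed h B * 1) σ τ
  rw [block_embed_mul h B, ← Matrix.mul_assoc A B, ← h1, mul_one, mul_one] at h2
  rw [← block_apply_restrict h σ τ (embed h (A * B)), ← h2, block_apply_restrict]

/-- The embedding of local observables as a homomorphism of C*-algebras. -/
def embedHom {X Λ : Finset Γ} (h : X ⊆ Λ) : LocalAlg ι X →⋆ₐ[ℂ] LocalAlg ι Λ where
  toFun := embed h
  map_one' := embed_one h
  map_mul' := embed_mul h
  map_zero' := by ext σ τ; simp [embed]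
  map_add' A B := by
    ext σ τ
    simp only [embed, Matrix.of_apply, Matrix.add_apply]
    split_ifs <;> simp
  commutes' c := by
    rw [Algebra.algebraMap_eq_smul_one, Algebra.algebraMap_eq_smul_one, ← embed_one h]
    ext σ τ
    simp [embed]
  map_star' A := (embed_conjTranspose h A).symm

theorem norm_embed_le {X Λ : Finset Γ} (h : X ⊆ Λ) (A : LocalAlg ι X) :
    ‖embed h A‖ ≤ ‖A‖ :=
  NonUnitalStarAlgHom.norm_apply_le (embedHom h) A

theorem IsLindblad.extend {Z Λ : Finset Γ} (h : Z ⊆ Λ)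
    {Φ : LocalAlg ι Z →ₗ[ℂ] LocalAlg ι Z} (hΦ : IsLindblad Φ) : IsLindblad (extend h Φ) := by
  obtain ⟨H, l, K, hH, hΦ⟩ := hΦ
  refine ⟨embed h H, l, fun j => embed h (K j), ?_, fun M => ?_⟩
  · rw [Matrix.IsHermitian, embed_conjTranspose, hH.eq]
  · ext σ τ
    refine Eq.trans ?_ (block_apply_restrict h σ τ _)
    rw [extend_apply, hΦ]
    simp only [map_add, map_sub, map_smul, map_sum, embed_conjTranspose, ← embed_mul,
      block_embed_mul, block_mul_embed]

/-- A linear map on matrices through its values on matrix units. -/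
theorem linearMap_apply_eq_sum {m : Type*} [Fintype m] [DecidableEq m]
    (Φ : Matrix m m ℂ →ₗ[ℂ] Matrix m m ℂ) (N : Matrix m m ℂ) (i j : m) :
    Φ N i j = ∑ a, ∑ b, N a b * Φ (Matrix.single a b 1) i j := by
  conv_lhs => rw [Matrix.matrix_eq_sum_single N]
  simp only [map_sum, Matrix.sum_apply]
  refine Finset.sum_congr rfl fun a _ => Finset.sum_congr rfl fun b _ => ?_
  rw [← mul_one (N a b), ← smul_eq_mul, ← Matrix.smul_single, map_smul]
  simp

/-- Expanded in matrix units, both sides are the same fourfold sum in a different order, because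
gluing on disjoint sets commutes. -/
theorem extend_comm {Z Z' Λ : Finset Γ} (h : Z ⊆ Λ) (h' : Z' ⊆ Λ) (hd : Disjoint Z Z')
    (Φ : LocalAlg ι Z →ₗ[ℂ] LocalAlg ι Z) (Ψ : LocalAlg ι Z' →ₗ[ℂ] LocalAlg ι Z')
    (M : LocalAlg ι Λ) : extend h Φ (extend h' Ψ M) = extend h' Ψ (extend h Φ M) := by
  ext σ τ
  have e1 : ∀ a b, block Z σ τ (extend h' Ψ M) a b = ∑ c, ∑ d, M (c.glue (a.glue σ))
      (d.glue (b.glue τ)) * Ψ (Matrix.single c d 1) (σ.restrict h') (τ.restrict h') := by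
    intro a b
    change extend h' Ψ M (a.glue σ) (b.glue τ) = _
    rw [extend_apply, linearMap_apply_eq_sum, Config.restrict_glue_of_disjoint hd,
      Config.restrict_glue_of_disjoint hd]
    rfl
  have e2 : ∀ c d, block Z' σ τ (extend h Φ M) c d = ∑ a, ∑ b, M (a.glue (c.glue σ))
      (b.glue (d.glue τ)) * Φ (Matrix.single a b 1) (σ.restrict h) (τ.restrict h) := by
    intro c d
    change extend h Φ M (c.glue σ) (d.glue τ) = _
    rw [extend_apply, linearMap_apply_eq_sum, Config.restrict_glue_of_disjoint hd.symm,
      Config.restrict_glue_of_disjoint hd.symm]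
    rfl
  rw [extend_apply, extend_apply, linearMap_apply_eq_sum, linearMap_apply_eq_sum Ψ]
  simp only [e1, e2, Finset.sum_mul, ← Fintype.sum_prod_type']
  refine Fintype.sum_equiv
    { toFun := fun x => (x.2.2.1, x.2.2.2, x.1, x.2.1)
      invFun := fun x => (x.2.2.1, x.2.2.2, x.1, x.2.1)
      left_inv := fun _ => rfl
      right_inv := fun _ => rfl } _ _ fun x => ?_
  change _ * _ * _ = M (x.1.glue (x.2.2.1.glue σ)) (x.2.1.glue (x.2.2.2.glue τ)) * _ * _
  rw [Config.glue_glue_comm hd, Config.glue_glue_comm hd]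
  exact mul_right_comm _ _ _

/-- The splitting of the configurations on `Λ` into those on `Z` and on `Λ \ Z`. -/
def Config.split {Z Λ : Finset Γ} (h : Z ⊆ Λ) :
    Config ι Λ ≃ Config ι Z × Config ι (Λ \ Z) where
  toFun σ := (σ.restrict h, σ.restrict Finset.sdiff_subset)
  invFun p x := if hx : x.1 ∈ Z then p.1 ⟨x.1, hx⟩
    else p.2 ⟨x.1, Finset.mem_sdiff.2 ⟨x.2, hx⟩⟩
  left_inv σ := by
    ext x
    by_cases hx : x.1 ∈ Z <;> simp [Config.restrict, hx]
  right_inv p := by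
    refine Prod.ext ?_ ?_
    · ext x; simp [Config.restrict]
    · ext x
      have := (Finset.mem_sdiff.1 x.2).2
      simp [Config.restrict, this]

/-- Numbering the configurations on Λ \ Z turns the extension into an ampliation, up to a
relabelling of the basis that preserves norms. This is where the completely bounded norm is needed.
-/
theorem norm_extend_le {Z Λ : Finset Γ} (h : Z ⊆ Λ) {Φ : LocalAlg ι Z →ₗ[ℂ] LocalAlg ι Z}
    (hΦ : cbNorm Φ < ∞) (M : LocalAlg ι Λ) :
    ‖extend h Φ M‖ ≤ (cbNorm Φ).toReal * ‖M‖ := by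
  let e : Config ι Λ ≃ Config ι Z × Fin (Fintype.card (Config ι (Λ \ Z))) :=
    (Config.split h).trans ((Equiv.refl _).prodCongr (Fintype.equivFin _))
  have he : Matrix.reindex e e (extend h Φ M) = ampliation _ Φ (Matrix.reindex e e M) := by
    have hglue : ∀ (a : Config ι Z) p, a.glue (e.symm p) = e.symm (a, p.2) := by
      intro a p
      ext x
      by_cases hx : x.1 ∈ Z
      · rw [Config.glue_of_mem _ _ hx]
        simp [e, Config.split, hx]
      · rw [Config.glue_of_notMem _ _ hx]
        simp [e, Config.split, hx]
    have hres : ∀ p, (e.symm p).restrict h = p.1 := fun p =>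
      congrArg Prod.fst (e.apply_symm_apply p)
    ext p q
    change extend h Φ M (e.symm p) (e.symm q) = Φ (Matrix.of fun a b =>
      M (e.symm (a, p.2)) (e.symm (b, q.2))) p.1 q.1
    rw [extend_apply, hres, hres]
    have hb : block Z (e.symm p) (e.symm q) M
        = Matrix.of fun a b => M (e.symm (a, p.2)) (e.symm (b, q.2)) := by
      ext a b
      change M (a.glue (e.symm p)) (b.glue (e.symm q)) = _
      rw [hglue, hglue]
      rfl
    rw [hb]
  rw [← norm_reindex e, he, ← norm_reindex e M]
  exact norm_ampliation_le hΦ _ _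

end Local

/-! ### Power laws on regular metric spaces -/

section Regular

variable {Γ : Type*} [MetricSpace Γ]

theorem powerLaw_pos (α : ℝ) {r : ℝ} (hr : 0 ≤ r) : 0 < powerLaw α r := by
  unfold powerLaw; positivity

theorem powerLaw_antitone {α : ℝ} (hα : 0 ≤ α) {r s : ℝ} (hr : 0 ≤ r) (hrs : r ≤ s) :
    powerLaw α s ≤ powerLaw α r :=
  one_div_le_one_div_of_le (by positivity)
    (Real.rpow_le_rpow (by positivity) (by linarith) hα)

theorem powerLaw_add (α β : ℝ) {r : ℝ} (hr : 0 ≤ r) :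
    powerLaw (α + β) r = powerLaw α r * powerLaw β r := by
  unfold powerLaw
  rw [Real.rpow_add (by positivity), one_div_mul_one_div]

theorem summable_powerLaw_nat {ε : ℝ} (hε : 0 < ε) :
    Summable fun n : ℕ => 1 / (1 + (n : ℝ)) ^ (1 + ε) := by
  have h := (Real.summable_one_div_nat_rpow (p := 1 + ε)).2 (by linarith)
  refine ((summable_nat_add_iff 1).2 h).congr fun n => ?_
  push_cast
  rw [add_comm (1 : ℝ) (n : ℝ)]

theorem IsRegular.card_filter_le {κ ν : ℝ} (h : IsRegular Γ κ ν) (x : Γ) (n : ℕ)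
    (s : Finset Γ) (hs : ∀ y ∈ s, dist x y ≤ (n : ℝ) + 1) :
    (s.card : ℝ) ≤ κ * ((n : ℝ) + 1) ^ ν := by
  refine le_trans ?_ (h x n).2
  rw [← Set.ncard_coe_finset]
  refine Nat.cast_le.2 (Set.ncard_le_ncard (fun y hy => ?_) (h x n).1)
  rw [Metric.mem_closedBall, dist_comm]
  exact hs y hy

/-- Group the points by n = ⌊dist⌋. Such a shell lies in the ball of radius n + 1, whose cardinality
bound κ(n+1)^ν cancels the ν in the exponent exactly. -/
theorem IsRegular.sum_powerLaw_le {κ ν : ℝ} (h : IsRegular Γ κ ν) (hκ : 0 < κ) (hν : 0 < ν)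
    {ε : ℝ} (hε : 0 < ε) (x : Γ) (s : Finset Γ) :
    ∑ y ∈ s, powerLaw (ν + (1 + ε)) (dist x y)
      ≤ κ * ∑' n : ℕ, 1 / (1 + (n : ℝ)) ^ (1 + ε) := by
  classical
  set N := s.sup fun y => ⌊dist x y⌋₊ with hN
  have hmaps : ∀ y ∈ s, ⌊dist x y⌋₊ ∈ Finset.range (N + 1) := fun y hy =>
    Finset.mem_range.2 (Nat.lt_succ_of_le (Finset.le_sup (f := fun y => ⌊dist x y⌋₊) hy))
  rw [← Finset.sum_fiberwise_of_maps_to hmaps]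
  have hfib : ∀ n ∈ Finset.range (N + 1),
      ∑ y ∈ s with ⌊dist x y⌋₊ = n, powerLaw (ν + (1 + ε)) (dist x y)
        ≤ κ * (1 / (1 + (n : ℝ)) ^ (1 + ε)) := by
    intro n _
    have h1 : ∀ y ∈ s.filter (fun y => ⌊dist x y⌋₊ = n),
        powerLaw (ν + (1 + ε)) (dist x y) ≤ powerLaw (ν + (1 + ε)) n := by
      intro y hy
      refine powerLaw_antitone (by linarith) (Nat.cast_nonneg n) ?_
      rw [← (Finset.mem_filter.1 hy).2]
      exact Nat.floor_le dist_nonneg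
    have h2 := h.card_filter_le x n (s.filter fun y => ⌊dist x y⌋₊ = n) (by
      intro y hy
      rw [← (Finset.mem_filter.1 hy).2]
      exact (Nat.lt_floor_add_one _).le)
    refine (Finset.sum_le_card_nsmul _ _ _ h1).trans ?_
    rw [nsmul_eq_mul]
    refine (mul_le_mul_of_nonneg_right h2 (powerLaw_pos _ (Nat.cast_nonneg n)).le).trans_eq ?_
    rw [powerLaw_add _ _ (Nat.cast_nonneg n), powerLaw, powerLaw, add_comm (n : ℝ) 1]
    have : (1 + (n : ℝ)) ^ ν ≠ 0 := by positivity
    field_simp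
  refine (Finset.sum_le_sum hfib).trans ?_
  rw [← Finset.mul_sum]
  refine mul_le_mul_of_nonneg_left ?_ hκ.le
  exact (summable_powerLaw_nat hε).sum_le_tsum _ fun n _ => by positivity

/-- The tail of a power law, with a loss of `ν + 1 + ε` in the exponent. -/
theorem IsRegular.sum_powerLaw_tail_le {κ ν : ℝ} (h : IsRegular Γ κ ν) (hκ : 0 < κ)
    (hν : 0 < ν) {ε β : ℝ} (hε : 0 < ε) (hβ : 0 ≤ β) {r : ℝ} (hr : 0 ≤ r) (x : Γ)
    (s : Finset Γ) (hs : ∀ y ∈ s, r ≤ dist x y) :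
    ∑ y ∈ s, powerLaw (β + (ν + (1 + ε))) (dist x y)
      ≤ κ * (∑' n : ℕ, 1 / (1 + (n : ℝ)) ^ (1 + ε)) * powerLaw β r := by
  have h1 : ∀ y ∈ s, powerLaw (β + (ν + (1 + ε))) (dist x y)
      ≤ powerLaw β r * powerLaw (ν + (1 + ε)) (dist x y) := by
    intro y hy
    rw [powerLaw_add _ _ dist_nonneg]
    exact mul_le_mul_of_nonneg_right (powerLaw_antitone hβ hr (hs y hy))
      (powerLaw_pos _ dist_nonneg).le
  refine (Finset.sum_le_sum h1).trans ?_
  rw [← Finset.mul_sum, mul_comm]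
  exact mul_le_mul_of_nonneg_right (h.sum_powerLaw_le hκ hν hε x s) (powerLaw_pos _ hr).le

/-- One of the two distances from z is at least half of dist x y; this costs the factor 2^α. -/
theorem powerLaw_mul_powerLaw_le {α : ℝ} (hα : 0 ≤ α) (x y z : Γ) :
    powerLaw α (dist x z) * powerLaw α (dist z y)
      ≤ 2 ^ α * (powerLaw α (dist x z) + powerLaw α (dist y z)) * powerLaw α (dist x y) := by
  have hhalf : ∀ r : ℝ, dist x y / 2 ≤ r → powerLaw α r ≤ 2 ^ α * powerLaw α (dist x y) := by
    intro r hr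
    have hd : (0 : ℝ) ≤ dist x y := dist_nonneg
    refine (powerLaw_antitone hα (by positivity) hr).trans ?_
    unfold powerLaw
    rw [mul_one_div, div_le_div_iff₀ (by positivity) (by positivity), one_mul,
      ← Real.mul_rpow (by positivity) (by positivity)]
    exact Real.rpow_le_rpow (by positivity) (by linarith) hα
  have h1 := (powerLaw_pos α (dist_nonneg (x := x) (y := z))).le
  have h2 := (powerLaw_pos α (dist_nonneg (x := y) (y := z))).le
  have h3 := (powerLaw_pos α (dist_nonneg (x := x) (y := y))).le
  have h4 : (0 : ℝ) ≤ 2 ^ α := by positivity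
  have h5 := mul_nonneg (mul_nonneg h4 h1) h3
  have h6 := mul_nonneg (mul_nonneg h4 h2) h3
  have htri := dist_triangle x z y
  rw [dist_comm z y] at htri ⊢
  rcases le_total (dist x z) (dist y z) with hle | hle
  · have := mul_le_mul_of_nonneg_left (hhalf (dist y z) (by linarith)) h1
    nlinarith
  · have := mul_le_mul_of_nonneg_right (hhalf (dist x z) (by linarith)) h2
    nlinarith

/-- Finiteness has to be proved because `toReal` would turn an infinite constant into 0. -/
theorem IsRegular.convConst_powerLaw_lt_top {κ ν : ℝ} (h : IsRegular Γ κ ν) (hκ : 0 < κ)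
    (hν : 0 < ν) {ε β : ℝ} (hε : 0 < ε) (hβ : 0 ≤ β) :
    convConst Γ (powerLaw (β + (ν + (1 + ε)))) < ∞ := by
  set α := β + (ν + (1 + ε)) with hα
  set B := κ * (∑' n : ℕ, 1 / (1 + (n : ℝ)) ^ (1 + ε)) * powerLaw β 0 with hB
  have hsum : ∀ (x : Γ) (s : Finset Γ), ∑ y ∈ s, powerLaw α (dist x y) ≤ B := fun x s =>
    h.sum_powerLaw_tail_le hκ hν hε hβ le_rfl x s fun _ _ => dist_nonneg
  have hpos : ∀ x y : Γ, 0 ≤ powerLaw α (dist x y) := fun x y =>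
    (powerLaw_pos α dist_nonneg).le
  refine lt_of_le_of_lt (sInf_le (a := ENNReal.ofReal (2 ^ α * (B + B))) ?_)
    ENNReal.ofReal_lt_top
  intro x y
  rw [ENNReal.tsum_eq_iSup_sum]
  refine iSup_le fun s => ?_
  have hB0 : 0 ≤ B := (Finset.sum_nonneg fun y _ => hpos x y).trans (hsum x ∅)
  rw [← ENNReal.ofReal_mul (by positivity)]
  simp only [← ENNReal.ofReal_mul (hpos _ _)]
  rw [← ENNReal.ofReal_sum_of_nonneg fun z _ => mul_nonneg (hpos _ _) (hpos _ _)]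
  refine ENNReal.ofReal_le_ofReal ?_
  refine (Finset.sum_le_sum fun z _ =>
    powerLaw_mul_powerLaw_le (α := α) (by positivity) x y z).trans ?_
  rw [← Finset.sum_mul, ← Finset.mul_sum, Finset.sum_add_distrib]
  refine mul_le_mul_of_nonneg_right ?_ (hpos x y)
  exact mul_le_mul_of_nonneg_left (add_le_add (hsum x s) (hsum y s)) (by positivity)

/-- The infimum is attained: since F is positive and finite, one may divide by it. -/
theorem convConst_spec (F : ℝ → ℝ) (hF : ∀ r, 0 ≤ r → 0 < F r) (x y : Γ) :
    ∑' z : Γ, ENNReal.ofReal (F (dist x z)) * ENNReal.ofReal (F (dist z y))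
      ≤ convConst Γ F * ENNReal.ofReal (F (dist x y)) := by
  have h0 : ENNReal.ofReal (F (dist x y)) ≠ 0 := by
    simpa using hF _ dist_nonneg
  rw [← ENNReal.div_le_iff h0 ENNReal.ofReal_ne_top]
  exact le_sInf fun C hC => (ENNReal.div_le_iff h0 ENNReal.ofReal_ne_top).2 (hC x y)

theorem sum_mul_le_convConst (F : ℝ → ℝ) (hF : ∀ r, 0 ≤ r → 0 < F r)
    (hC : convConst Γ F < ∞) (x y : Γ) (s : Finset Γ) :
    ∑ z ∈ s, F (dist x z) * F (dist z y) ≤ (convConst Γ F).toReal * F (dist x y) := by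
  have hpos : ∀ x y : Γ, 0 ≤ F (dist x y) := fun x y => (hF _ dist_nonneg).le
  have h1 := (ENNReal.sum_le_tsum s).trans (convConst_spec F hF x y)
  simp only [← ENNReal.ofReal_mul (hpos _ _)] at h1
  rw [← ENNReal.ofReal_sum_of_nonneg fun z _ => mul_nonneg (hpos _ _) (hpos _ _),
    ← ENNReal.ofReal_toReal hC.ne, ← ENNReal.ofReal_mul ENNReal.toReal_nonneg] at h1
  exact (ENNReal.ofReal_le_ofReal_iff (mul_nonneg ENNReal.toReal_nonneg (hpos x y))).1 h1

theorem convConst_toReal_pos (F : ℝ → ℝ) (hF : ∀ r, 0 ≤ r → 0 < F r)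
    (hC : convConst Γ F < ∞) (x : Γ) : 0 < (convConst Γ F).toReal := by
  have h := sum_mul_le_convConst F hF hC x x {x}
  rw [Finset.sum_singleton] at h
  have h0 := hF (dist x x) dist_nonneg
  exact pos_of_mul_pos_left ((mul_pos h0 h0).trans_le h) h0.le

end Regular

/-! ### The `F`-norm -/

section FNorm

variable {Γ : Type*} [DecidableEq Γ] [MetricSpace Γ] {ι : Γ → Type*} [∀ x, Fintype (ι x)]
  [∀ x, DecidableEq (ι x)]

theorem Interaction.fNorm_spec (L : Interaction ι) (F : ℝ → ℝ) (hF : ∀ r, 0 ≤ r → 0 < F r)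
    (x y : Γ) : ∑' Z : {Z : Finset Γ // x ∈ Z ∧ y ∈ Z}, cbNorm (L.term Z.1)
      ≤ L.fNorm F * ENNReal.ofReal (F (dist x y)) := by
  have h0 : ENNReal.ofReal (F (dist x y)) ≠ 0 := by
    simpa using hF _ dist_nonneg
  rw [← ENNReal.div_le_iff h0 ENNReal.ofReal_ne_top]
  exact le_sInf fun C hC => (ENNReal.div_le_iff h0 ENNReal.ofReal_ne_top).2 (hC x y)

theorem Interaction.sum_cbNorm_le (L : Interaction ι) (F : ℝ → ℝ)
    (hF : ∀ r, 0 ≤ r → 0 < F r) (x y : Γ) (s : Finset (Finset Γ))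
    (hs : ∀ Z ∈ s, x ∈ Z ∧ y ∈ Z) :
    ∑ Z ∈ s, cbNorm (L.term Z) ≤ L.fNorm F * ENNReal.ofReal (F (dist x y)) := by
  refine le_trans ?_ (L.fNorm_spec F hF x y)
  rw [← Finset.sum_subtype_of_mem (fun Z => cbNorm (L.term Z)) hs]
  exact ENNReal.sum_le_tsum _

theorem Interaction.cbNorm_term_lt_top (L : Interaction ι) (F : ℝ → ℝ)
    (hF : ∀ r, 0 ≤ r → 0 < F r) (hL : L.fNorm F < ∞) {Z : Finset Γ} (hZ : Z.Nonempty) :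
    cbNorm (L.term Z) < ∞ := by
  obtain ⟨x, hx⟩ := hZ
  have h := L.sum_cbNorm_le F hF x x {Z} (by simpa using hx)
  rw [Finset.sum_singleton] at h
  exact h.trans_lt (ENNReal.mul_lt_top hL ENNReal.ofReal_lt_top)

theorem Interaction.sum_cbNorm_toReal_le (L : Interaction ι) (F : ℝ → ℝ)
    (hF : ∀ r, 0 ≤ r → 0 < F r) (hL : L.fNorm F < ∞) (x y : Γ) (s : Finset (Finset Γ))
    (hs : ∀ Z ∈ s, x ∈ Z ∧ y ∈ Z) :
    ∑ Z ∈ s, (cbNorm (L.term Z)).toReal ≤ (L.fNorm F).toReal * F (dist x y) := by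
  have h := ENNReal.toReal_mono (ENNReal.mul_lt_top hL ENNReal.ofReal_lt_top).ne
    (L.sum_cbNorm_le F hF x y s hs)
  rwa [ENNReal.toReal_sum fun Z hZ => (L.cbNorm_term_lt_top F hF hL ⟨x, (hs Z hZ).1⟩).ne,
    ENNReal.toReal_mul, ENNReal.toReal_ofReal (hF _ dist_nonneg).le] at h

end FNorm

/-! ### Sums over families of finite sets -/

section Families

variable {Γ : Type*} [DecidableEq Γ]

theorem sum_mul_sum_mem_eq (T : Finset (Finset Γ)) (Λ : Finset Γ) (hT : ∀ Z ∈ T, Z ⊆ Λ)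
    (w : Finset Γ → ℝ) (u : Γ → ℝ) :
    ∑ Z ∈ T, w Z * ∑ z ∈ Z, u z = ∑ z ∈ Λ, u z * ∑ Z ∈ T with z ∈ Z, w Z := by
  simp only [Finset.mul_sum, Finset.sum_filter]
  rw [Finset.sum_comm]
  refine Finset.sum_congr rfl fun Z hZ => ?_
  simp only [mul_ite, mul_zero]
  rw [← Finset.sum_filter, Finset.filter_mem_eq_inter, Finset.inter_eq_right.2 (hT Z hZ)]
  exact Finset.sum_congr rfl fun z _ => mul_comm _ _

theorem sum_not_disjoint_le (T : Finset (Finset Γ)) (Y : Finset Γ) (f : Finset Γ → ℝ)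
    (hf : ∀ Z, 0 ≤ f Z) :
    ∑ Z ∈ T with ¬ Disjoint Z Y, f Z ≤ ∑ y ∈ Y, ∑ Z ∈ T with y ∈ Z, f Z := by
  simp only [Finset.sum_filter]
  rw [Finset.sum_comm]
  refine Finset.sum_le_sum fun Z _ => ?_
  have h0 : ∀ y ∈ Y, 0 ≤ (if y ∈ Z then f Z else 0) := fun y _ => by
    split_ifs
    exacts [hf Z, le_rfl]
  split_ifs with hd
  · exact Finset.sum_nonneg h0
  · obtain ⟨y, hyZ, hyY⟩ := Finset.not_disjoint_iff.1 hd
    exact (if_pos hyZ).ge.trans (Finset.single_le_sum h0 hyY)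

end Families

/-! ### Lieb–Robinson bounds -/

section LiebRobinson

variable {Γ : Type*} [MetricSpace Γ]

/-- The decay function `F` with an additional exponential factor at scale `R`. -/
def damped (F : ℝ → ℝ) (R r : ℝ) : ℝ := F r * Real.exp (-(r / R))

/-- By the triangle inequality the exponential factor is submultiplicative along x, z, y, so damping
keeps the convolution constant. -/
theorem sum_damped_mul_le {F : ℝ → ℝ} (hF : ∀ r, 0 ≤ r → 0 ≤ F r) {R C : ℝ} (hR : 0 < R)
    {Λ : Finset Γ} {x y : Γ}
    (hconv : ∑ z ∈ Λ, F (dist x z) * F (dist z y) ≤ C * F (dist x y)) :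
    ∑ z ∈ Λ, damped F R (dist x z) * damped F R (dist z y) ≤ C * damped F R (dist x y) := by
  have h : ∀ z ∈ Λ, damped F R (dist x z) * damped F R (dist z y)
      ≤ F (dist x z) * F (dist z y) * Real.exp (-(dist x y / R)) := by
    intro z _
    have e : damped F R (dist x z) * damped F R (dist z y) = F (dist x z) * F (dist z y)
        * Real.exp (-((dist x z + dist z y) / R)) := by
      unfold damped
      rw [add_div, neg_add, Real.exp_add]
      ring
    rw [e]
    refine mul_le_mul_of_nonneg_left (Real.exp_le_exp.2 (neg_le_neg ?_))
      (mul_nonneg (hF _ dist_nonneg) (hF _ dist_nonneg))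
    exact div_le_div_of_nonneg_right (dist_triangle x z y) hR.le
  refine (Finset.sum_le_sum h).trans ?_
  rw [← Finset.sum_mul, damped, ← mul_assoc]
  exact mul_le_mul_of_nonneg_right hconv (Real.exp_pos _).le

/-- The subsets of `Λ` of diameter at most `R`. -/
def shortSets (Λ : Finset Γ) (R : ℝ) : Finset (Finset Γ) := by
  classical exact Λ.powerset.filter fun Z => ∀ x ∈ Z, ∀ y ∈ Z, dist x y ≤ R

theorem mem_shortSets {Λ : Finset Γ} {R : ℝ} {Z : Finset Γ} :
    Z ∈ shortSets Λ R ↔ Z ⊆ Λ ∧ ∀ x ∈ Z, ∀ y ∈ Z, dist x y ≤ R := by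
  simp [shortSets]

/-- For u ≤ r/R one has exp(-r/R)(e^u - 1) ≤ 1 - e^(-u), which is at most both u and 1. The bound by
u yields the factor t for the short part; the bound by 1 suffices for the long part. -/
theorem damped_mul_exp_sub_one_le {F : ℝ → ℝ} {R d u r C : ℝ} (hF : 0 ≤ F r) (hR : 0 < R)
    (hC : 0 < C) (hu : 0 ≤ u) (hud : u ≤ d / R) (hr : d ≤ r) :
    damped F R r * ((Real.exp u - 1) / C) ≤ F r * (min u 1 / C) := by
  unfold damped
  rw [mul_assoc]
  refine mul_le_mul_of_nonneg_left ?_ hF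
  rw [← mul_div_assoc]
  refine div_le_div_of_nonneg_right ?_ hC.le
  have h1 : Real.exp (-(r / R)) ≤ Real.exp (-u) := by
    have : d / R ≤ r / R := div_le_div_of_nonneg_right hr hR.le
    exact Real.exp_le_exp.2 (by linarith)
  have h2 : 0 ≤ Real.exp u - 1 := by linarith [Real.one_le_exp hu]
  have h3 : Real.exp (-u) * Real.exp u = 1 := by rw [← Real.exp_add]; simp
  have h4 := mul_le_mul_of_nonneg_right h1 h2
  have h5 := Real.add_one_le_exp (-u)
  have h6 := Real.exp_pos (-u)
  refine le_min ?_ ?_ <;> nlinarith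

/-- The weight with which the terms at `z` contribute to the propagation out of `X`. -/
def leakWeight (F : ℝ → ℝ) (C d : ℝ) (X : Finset Γ) (z : Γ) : ℝ :=
  ∑ x ∈ X, if dist x z < d then 1 else F (dist x z) / C

theorem leakWeight_nonneg {F : ℝ → ℝ} (hF : ∀ r, 0 ≤ r → 0 ≤ F r) {C : ℝ} (hC : 0 < C) (d : ℝ)
    (X : Finset Γ) (z : Γ) : 0 ≤ leakWeight F C d X z := by
  refine Finset.sum_nonneg fun x _ => ?_
  split_ifs
  exacts [zero_le_one, div_nonneg (hF _ dist_nonneg) hC.le]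

theorem sum_leakWeight_le {F : ℝ → ℝ} {C d N B : ℝ} (hC : 0 < C) (X Λ : Finset Γ)
    (hN : ∀ x (s : Finset Γ), (∀ y ∈ s, dist x y < d) → (s.card : ℝ) ≤ N)
    (hB : ∀ x (s : Finset Γ), (∀ y ∈ s, d ≤ dist x y) → ∑ y ∈ s, F (dist x y) ≤ B) :
    ∑ z ∈ Λ, leakWeight F C d X z ≤ X.card * (N + B / C) := by
  unfold leakWeight
  rw [Finset.sum_comm, ← nsmul_eq_mul]
  refine Finset.sum_le_card_nsmul _ _ _ fun x _ => ?_
  rw [Finset.sum_ite, ← Finset.sum_div]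
  refine add_le_add ?_ (div_le_div_of_nonneg_right (hB x _ fun y hy => ?_) hC.le)
  · simpa using hN x _ fun y hy => (Finset.mem_filter.1 hy).2
  · exact not_lt.1 (Finset.mem_filter.1 hy).2

variable [DecidableEq Γ] {E : Type*} [NormedAddCommGroup E] [NormedSpace ℂ E]
  [CompleteSpace E]

/-- The right-hand side of the Lieb–Robinson bound for the decay function `f` with convolution
constant `C` and an interaction of strength `M`. -/
def lrBound (f : ℝ → ℝ) (M C : ℝ) (X Y : Finset Γ) (s : ℝ) : ℝ :=
  ∑ y ∈ Y, ∑ x ∈ X, ((if x = y then 1 else 0)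
    + f (dist x y) * ((Real.exp (M * C * s) - 1) / C))

/-- The time derivative of `lrBound`. -/
def lrBoundDeriv (f : ℝ → ℝ) (M C : ℝ) (X Y : Finset Γ) (s : ℝ) : ℝ :=
  ∑ y ∈ Y, ∑ x ∈ X, M * f (dist x y) * Real.exp (M * C * s)

theorem hasDerivAt_lrBound (f : ℝ → ℝ) (M : ℝ) {C : ℝ} (hC : 0 < C) (X Y : Finset Γ) (s : ℝ) :
    HasDerivAt (lrBound f M C X Y) (lrBoundDeriv f M C X Y s) s := by
  refine HasDerivAt.fun_sum fun y _ => HasDerivAt.fun_sum fun x _ => ?_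
  have h1 : HasDerivAt (fun s : ℝ => M * C * s) (M * C) s := by
    simpa using (hasDerivAt_id s).const_mul (M * C)
  refine ((((h1.exp.sub_const 1).div_const C).const_mul (f (dist x y))).const_add
    _).congr_deriv ?_
  field_simp

theorem lrBound_nonneg {f : ℝ → ℝ} (hf : ∀ r, 0 ≤ r → 0 ≤ f r) {M C : ℝ} (hM : 0 ≤ M)
    (hC : 0 < C) (X Y : Finset Γ) {s : ℝ} (hs : 0 ≤ s) : 0 ≤ lrBound f M C X Y s := by
  refine Finset.sum_nonneg fun y _ => Finset.sum_nonneg fun x _ => add_nonneg ?_ ?_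
  · split_ifs <;> norm_num
  · have : 1 ≤ Real.exp (M * C * s) := Real.one_le_exp (by positivity)
    exact mul_nonneg (hf _ dist_nonneg) (div_nonneg (by linarith) hC.le)

theorem one_le_lrBound_zero (f : ℝ → ℝ) (M C : ℝ) {X Y : Finset Γ} (h : ¬ Disjoint X Y) :
    1 ≤ lrBound f M C X Y 0 := by
  obtain ⟨x, hxX, hxY⟩ := Finset.not_disjoint_iff.1 h
  have h0 : ∀ a b : Γ, (0 : ℝ) ≤ if a = b then 1 else 0 := fun a b => by
    split_ifs <;> norm_num
  simp only [lrBound, mul_zero, Real.exp_zero, sub_self, zero_div, add_zero]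
  refine le_trans ?_ (Finset.single_le_sum
    (fun y _ => Finset.sum_nonneg fun x _ => h0 x y) hxY)
  exact (if_pos rfl).ge.trans (Finset.single_le_sum (fun a _ => h0 a x) hxX)

/-- This is the supersolution inequality. The diagonal part of the bound contributes M·f, the
convolution part M·f·(e - 1), and together they give the derivative. -/
theorem sum_mul_lrBound_le (T : Finset (Finset Γ)) (Λ : Finset Γ) (hT : ∀ Z ∈ T, Z ⊆ Λ)
    (w : Finset Γ → ℝ) (hw : ∀ Z, 0 ≤ w Z) {f : ℝ → ℝ} (hf : ∀ r, 0 ≤ r → 0 ≤ f r)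
    {M C : ℝ} (hM : 0 ≤ M) (hC : 0 < C)
    (hwM : ∀ y z : Γ, ∑ Z ∈ T with y ∈ Z ∧ z ∈ Z, w Z ≤ M * f (dist y z))
    (hconv : ∀ x y : Γ, ∑ z ∈ Λ, f (dist x z) * f (dist z y) ≤ C * f (dist x y))
    (X Y : Finset Γ) {s : ℝ} (hs : 0 ≤ s) :
    ∑ Z ∈ T with ¬ Disjoint Z Y, w Z * lrBound f M C X Z s ≤ lrBoundDeriv f M C X Y s := by
  have hfd : ∀ x y : Γ, 0 ≤ f (dist x y) := fun x y => hf _ dist_nonneg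
  refine (sum_not_disjoint_le T Y _ fun Z =>
    mul_nonneg (hw Z) (lrBound_nonneg hf hM hC X Z hs)).trans ?_
  refine Finset.sum_le_sum fun y _ => ?_
  unfold lrBound
  rw [sum_mul_sum_mem_eq _ Λ fun Z hZ => hT Z (Finset.mem_filter.1 hZ).1]
  set e := Real.exp (M * C * s) with he
  have he1 : 1 ≤ e := Real.one_le_exp (by positivity)
  have hg : 0 ≤ (e - 1) / C := div_nonneg (by linarith) hC.le
  have h1 : ∀ z ∈ Λ, (∑ x ∈ X, ((if x = z then 1 else 0) + f (dist x z) * ((e - 1) / C)))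
      * ∑ Z ∈ (T.filter fun Z => y ∈ Z) with z ∈ Z, w Z
      ≤ ∑ x ∈ X, ((if x = z then 1 else 0) + f (dist x z) * ((e - 1) / C))
        * (M * f (dist z y)) := by
    intro z _
    rw [← Finset.sum_mul]
    refine mul_le_mul_of_nonneg_left ?_ (Finset.sum_nonneg fun x _ => add_nonneg ?_ ?_)
    · rw [Finset.filter_filter, dist_comm]
      exact hwM y z
    · split_ifs <;> norm_num
    · exact mul_nonneg (hfd x z) hg
  refine (Finset.sum_le_sum h1).trans ?_
  rw [Finset.sum_comm]
  refine Finset.sum_le_sum fun x _ => ?_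
  simp only [add_mul, Finset.sum_add_distrib]
  have h2 : ∑ z ∈ Λ, (if x = z then (1 : ℝ) else 0) * (M * f (dist z y))
      ≤ M * f (dist x y) := by
    simp only [ite_mul, one_mul, zero_mul, Finset.sum_ite_eq]
    split_ifs
    · exact le_rfl
    · exact mul_nonneg hM (hfd x y)
  have h3 : ∑ z ∈ Λ, f (dist x z) * ((e - 1) / C) * (M * f (dist z y))
      ≤ M * f (dist x y) * (e - 1) := by
    have : ∀ z, f (dist x z) * ((e - 1) / C) * (M * f (dist z y))
        = (M * ((e - 1) / C)) * (f (dist x z) * f (dist z y)) := fun z => by ring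
    simp only [this]
    rw [← Finset.mul_sum]
    refine (mul_le_mul_of_nonneg_left (hconv x y) (mul_nonneg hM hg)).trans_eq ?_
    field_simp
  linarith

/-- The Lieb–Robinson bound for a dissipative quantum system. -/
theorem lieb_robinson (T : Finset (Finset Γ)) (Λ : Finset Γ) (hT : ∀ Z ∈ T, Z ⊆ Λ)
    (l : Finset Γ → E →L[ℂ] E) (w : Finset Γ → ℝ) (hw : ∀ Z, 0 ≤ w Z)
    (hl : ∀ Z ∈ T, Z.Nonempty → ‖l Z‖ ≤ w Z)
    (hcontr : ∀ S ⊆ T, ∀ t : ℝ, 0 ≤ t → ‖flow (∑ Z ∈ S, l Z) t‖ ≤ 1)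
    (hcomm : ∀ Z ∈ T, ∀ Z' ∈ T, Disjoint Z Z' → Commute (l Z) (l Z'))
    {f : ℝ → ℝ} (hf : ∀ r, 0 ≤ r → 0 ≤ f r) {M C : ℝ} (hM : 0 ≤ M) (hC : 0 < C)
    (hwM : ∀ y z : Γ, ∑ Z ∈ T with y ∈ Z ∧ z ∈ Z, w Z ≤ M * f (dist y z))
    (hconv : ∀ x y : Γ, ∑ z ∈ Λ, f (dist x z) * f (dist z y) ≤ C * f (dist x y))
    (X : Finset Γ) (A : E) (hA : ∀ Z ∈ T, Disjoint X Z → l Z A = 0)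
    (Y : Finset Γ) (k : E →L[ℂ] E) {c : ℝ} (hc : ‖k‖ ≤ c)
    (hkcomm : ∀ Z ∈ T, Disjoint Z Y → Commute (l Z) k) (hkA : Disjoint X Y → k A = 0)
    {t : ℝ} (ht : 0 ≤ t) :
    ‖k (flow (∑ Z ∈ T, l Z) t A)‖ ≤ c * (‖A‖ * lrBound f M C X Y t) :=
  norm_apply_flow_le_of_supersolution T l w hw hl hcontr hcomm X A hA
    (fun Y s => lrBound f M C X Y s) (fun Y s => lrBoundDeriv f M C X Y s)
    (fun Y s => hasDerivAt_lrBound f M hC X Y s)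
    (fun Y => lrBound_nonneg hf hM hC X Y le_rfl) (fun _ => one_le_lrBound_zero f M C)
    (fun Y _ hs => sum_mul_lrBound_le T Λ hT w hw hf hM hC hwM hconv X Y hs)
    (fun Y _ hs => lrBound_nonneg hf hM hC X Y hs) Y k hc hkcomm hkA ht

/-! ### Truncation of the interaction at a length scale -/

theorem sum_shortSets_le {F : ℝ → ℝ} (hF : ∀ r, 0 ≤ r → 0 ≤ F r) {M R : ℝ} (hM : 0 ≤ M)
    (hR : 0 < R) (Λ : Finset Γ) (w : Finset Γ → ℝ) (y z : Γ)
    (hwM : ∀ T : Finset (Finset Γ), (∀ Z ∈ T, y ∈ Z ∧ z ∈ Z) →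
      ∑ Z ∈ T, w Z ≤ M * F (dist y z)) :
    ∑ Z ∈ shortSets Λ R with y ∈ Z ∧ z ∈ Z, w Z
      ≤ Real.exp 1 * M * damped F R (dist y z) := by
  have h0 := hF (dist y z) dist_nonneg
  by_cases hd : dist y z ≤ R
  · refine (hwM _ fun Z hZ => (Finset.mem_filter.1 hZ).2).trans ?_
    -- Within distance R the damping loses at most a factor e. This is the source of the e in the
    -- time condition and of the first summand e in the constant.
    have h1 : 1 ≤ Real.exp 1 * Real.exp (-(dist y z / R)) := by
      rw [← Real.exp_add]
      have := (div_le_one hR).2 hd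
      exact Real.one_le_exp (by linarith)
    have h2 := le_mul_of_one_le_right (mul_nonneg hM h0) h1
    unfold damped
    linarith
  · rw [Finset.filter_false_of_mem, Finset.sum_empty]
    · exact mul_nonneg (by positivity) (mul_nonneg h0 (Real.exp_pos _).le)
    · rintro Z hZ ⟨hy, hz⟩
      exact hd ((mem_shortSets.1 hZ).2 y hy z hz)

/-- If all points of Z were within R/2 of z, its diameter would be at most R; so a long set through
z contains a point y with dist z y ≥ R/2. -/
theorem sum_long_le {F : ℝ → ℝ} {M R B : ℝ} (hM : 0 ≤ M) (Λ : Finset Γ)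
    (w : Finset Γ → ℝ) (hw : ∀ Z, 0 ≤ w Z) (z : Γ)
    (hwM : ∀ y (T : Finset (Finset Γ)), (∀ Z ∈ T, z ∈ Z ∧ y ∈ Z) →
      ∑ Z ∈ T, w Z ≤ M * F (dist z y))
    (hB : ∀ s : Finset Γ, (∀ y ∈ s, R / 2 ≤ dist z y) → ∑ y ∈ s, F (dist z y) ≤ B) :
    ∑ Z ∈ Λ.powerset \ shortSets Λ R with z ∈ Z, w Z ≤ M * B := by
  classical
  set T := (Λ.powerset \ shortSets Λ R).filter fun Z => z ∈ Z with hT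
  set V := Λ.filter fun y => R / 2 ≤ dist z y with hV
  have h1 : ∑ Z ∈ T, w Z ≤ ∑ y ∈ V, ∑ Z ∈ T with y ∈ Z, w Z := by
    refine le_trans (Finset.sum_le_sum_of_subset_of_nonneg (fun Z hZ => ?_)
      fun Z _ _ => hw Z) (sum_not_disjoint_le T V w hw)
    refine Finset.mem_filter.2 ⟨hZ, fun hdis => ?_⟩
    obtain ⟨hZ1, hz⟩ := Finset.mem_filter.1 hZ
    obtain ⟨hZΛ, hZs⟩ := Finset.mem_sdiff.1 hZ1
    rw [Finset.mem_powerset] at hZΛ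
    refine hZs (mem_shortSets.2 ⟨hZΛ, fun x hx y hy => ?_⟩)
    have hsmall : ∀ x ∈ Z, dist z x < R / 2 := fun x hx => by
      by_contra hcon
      exact Finset.disjoint_left.1 hdis hx
        (Finset.mem_filter.2 ⟨hZΛ hx, not_lt.1 hcon⟩)
    have := dist_triangle_left x y z
    linarith [hsmall x hx, hsmall y hy]
  refine h1.trans ((Finset.sum_le_sum fun y _ => hwM y _ fun Z hZ => ?_).trans ?_)
  · obtain ⟨hZ1, hy⟩ := Finset.mem_filter.1 hZ
    exact ⟨(Finset.mem_filter.1 hZ1).2, hy⟩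
  · rw [← Finset.mul_sum]
    exact mul_le_mul_of_nonneg_left (hB V fun y hy => (Finset.mem_filter.1 hy).2) hM

theorem lrBound_damped_le {F : ℝ → ℝ} (hF : ∀ r, 0 ≤ r → 0 ≤ F r) {M R d C s : ℝ}
    (hR : 0 < R) (hC : 0 < C) (hd : 0 < d) (hu : 0 ≤ M * C * s) (hud : M * C * s ≤ d / R)
    (X Y : Finset Γ) (hXY : ∀ x ∈ X, ∀ y ∈ Y, d ≤ dist x y) :
    lrBound (damped F R) M C X Y s
      ≤ ∑ y ∈ Y, ∑ x ∈ X, F (dist x y) * (min (M * C * s) 1 / C) := by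
  refine Finset.sum_le_sum fun y hy => Finset.sum_le_sum fun x hx => ?_
  have hxy := hXY x hx y hy
  have hne : x ≠ y := by
    rintro rfl
    rw [dist_self] at hxy
    linarith
  rw [if_neg hne, zero_add]
  exact damped_mul_exp_sub_one_le (hF _ dist_nonneg) hR hC hu hud hxy

/-- Propagation estimate by truncation of the interaction at the scale `R`. -/
theorem norm_apply_flow_le_of_truncation (Λ : Finset Γ)
    (l : Finset Γ → E →L[ℂ] E) (w : Finset Γ → ℝ) (hw : ∀ Z, 0 ≤ w Z)
    (hl : ∀ Z ∈ Λ.powerset, Z.Nonempty → ‖l Z‖ ≤ w Z)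
    (hcontr : ∀ S ⊆ Λ.powerset, ∀ t : ℝ, 0 ≤ t → ‖flow (∑ Z ∈ S, l Z) t‖ ≤ 1)
    (hcomm : ∀ Z ∈ Λ.powerset, ∀ Z' ∈ Λ.powerset, Disjoint Z Z' → Commute (l Z) (l Z'))
    {F : ℝ → ℝ} (hF : ∀ r, 0 ≤ r → 0 ≤ F r) {M C : ℝ} (hM : 0 ≤ M) (hC : 0 < C)
    (hwM : ∀ (y z : Γ) (T : Finset (Finset Γ)), (∀ Z ∈ T, y ∈ Z ∧ z ∈ Z) →
      ∑ Z ∈ T, w Z ≤ M * F (dist y z))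
    (hconv : ∀ x y : Γ, ∑ z ∈ Λ, F (dist x z) * F (dist z y) ≤ C * F (dist x y))
    (X : Finset Γ) (A : E) (hA : ∀ Z ∈ Λ.powerset, Disjoint X Z → l Z A = 0)
    (Y : Finset Γ) (k : E →L[ℂ] E) {c : ℝ} (hc : ‖k‖ ≤ c)
    (hkcomm : ∀ Z ∈ Λ.powerset, Disjoint Z Y → Commute (l Z) k) (hkA : k A = 0)
    {R d t N B₁ B₂ : ℝ} (hR : 0 < R) (hd : 0 < d) (hXY : ∀ x ∈ X, ∀ y ∈ Y, d ≤ dist x y)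
    (hN : ∀ x (s : Finset Γ), (∀ y ∈ s, dist x y < d) → (s.card : ℝ) ≤ N)
    (hB₁ : ∀ x (s : Finset Γ), (∀ y ∈ s, d ≤ dist x y) → ∑ y ∈ s, F (dist x y) ≤ B₁)
    (hB₂ : ∀ x (s : Finset Γ), (∀ y ∈ s, R / 2 ≤ dist x y) → ∑ y ∈ s, F (dist x y) ≤ B₂)
    (hB₂0 : 0 ≤ B₂) (ht : 0 ≤ t) (htR : Real.exp 1 * M * C * t ≤ d / R) :
    ‖k (flow (∑ Z ∈ Λ.powerset, l Z) t A)‖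
      ≤ c * (‖A‖ * (X.card * (M * t * (Real.exp 1 * B₁ + B₂ * (N + B₁ / C))))) := by
  have hc0 : 0 ≤ c := (norm_nonneg k).trans hc
  have hS : shortSets Λ R ⊆ Λ.powerset := fun Z hZ =>
    Finset.mem_powerset.2 (mem_shortSets.1 hZ).1
  set P := ∑ Z ∈ shortSets Λ R, l Z with hP
  set Q := ∑ Z ∈ Λ.powerset \ shortSets Λ R, l Z with hQ
  have hPQ : ∑ Z ∈ Λ.powerset, l Z = P + Q := by
    rw [add_comm]; exact (Finset.sum_sdiff hS).symm
  have heM : 0 ≤ Real.exp 1 * M := by positivity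
  have hu : ∀ s : ℝ, 0 ≤ s → 0 ≤ Real.exp 1 * M * C * s := fun s hs => by positivity
  have hus : ∀ s : ℝ, s ≤ t → Real.exp 1 * M * C * s ≤ d / R := fun s hs =>
    (mul_le_mul_of_nonneg_left hs (by positivity)).trans htR
  have hLR : ∀ (Y : Finset Γ) (k : E →L[ℂ] E) (c : ℝ), ‖k‖ ≤ c →
      (∀ Z ∈ shortSets Λ R, Disjoint Z Y → Commute (l Z) k) → (Disjoint X Y → k A = 0) →
      ∀ s : ℝ, 0 ≤ s → ‖k (flow P s A)‖
        ≤ c * (‖A‖ * lrBound (damped F R) (Real.exp 1 * M) C X Y s) := by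
    intro Y k c hc hkc hkA s hs
    exact lieb_robinson (shortSets Λ R) Λ (fun Z hZ => (mem_shortSets.1 hZ).1) l w hw
      (fun Z hZ => hl Z (hS hZ)) (fun S hSs => hcontr S (hSs.trans hS))
      (fun Z hZ Z' hZ' => hcomm Z (hS hZ) Z' (hS hZ'))
      (f := damped F R) (fun r hr => mul_nonneg (hF r hr) (Real.exp_pos _).le) heM hC
      (fun y z => sum_shortSets_le hF hM hR Λ w y z (hwM y z))
      (fun x y => sum_damped_mul_le hF hR (hconv x y)) X A (fun Z hZ => hA Z (hS hZ))
      Y k hc hkc hkA hs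
  have hB₁Y : ∑ y ∈ Y, ∑ x ∈ X, F (dist x y) ≤ X.card * B₁ := by
    rw [Finset.sum_comm, ← nsmul_eq_mul]
    exact Finset.sum_le_card_nsmul _ _ _ fun x hx => hB₁ x Y (hXY x hx)
  have hshort : ‖k (flow P t A)‖ ≤ c * (‖A‖ * (X.card * B₁ * (Real.exp 1 * M * t))) := by
    refine (hLR Y k c hc (fun Z hZ => hkcomm Z (hS hZ)) (fun _ => hkA) t ht).trans ?_
    refine mul_le_mul_of_nonneg_left (mul_le_mul_of_nonneg_left ?_ (norm_nonneg _)) hc0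
    refine (lrBound_damped_le hF hR hC hd (hu t ht) (hus t le_rfl) X Y hXY).trans ?_
    simp only [← Finset.sum_mul]
    have h1 : min (Real.exp 1 * M * C * t) 1 / C ≤ Real.exp 1 * M * t := by
      rw [div_le_iff₀ hC]
      exact (min_le_left _ _).trans_eq (by ring)
    have h2 : 0 ≤ ∑ y ∈ Y, ∑ x ∈ X, F (dist x y) :=
      Finset.sum_nonneg fun y _ => Finset.sum_nonneg fun x _ => hF _ dist_nonneg
    exact (mul_le_mul_of_nonneg_left h1 h2).trans
      (mul_le_mul_of_nonneg_right hB₁Y (by positivity))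
  have hq0 : ∀ z, 0 ≤ leakWeight F C d X z := leakWeight_nonneg hF hC d X
  -- A set closer than d to X has total leak weight at least 1, so the contractive bound suffices.
  -- For all other sets the Lieb–Robinson bound of the short dynamics applies, with `l Z` as the
  -- test map.
  have hterm : ∀ Z ∈ Λ.powerset \ shortSets Λ R, ∀ s : ℝ, 0 ≤ s → s ≤ t →
      ‖l Z (flow P s A)‖ ≤ ‖A‖ * (w Z * ∑ z ∈ Z, leakWeight F C d X z) := by
    intro Z hZ s hs hst
    obtain ⟨hZΛ, hZs⟩ := Finset.mem_sdiff.1 hZ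
    have hne : Z.Nonempty := by
      rw [Finset.nonempty_iff_ne_empty]
      rintro rfl
      exact hZs (mem_shortSets.2 ⟨Finset.empty_subset _, by simp⟩)
    have hlZ := hl Z hZΛ hne
    by_cases hnear : ∃ z ∈ Z, ∃ x ∈ X, dist x z < d
    · obtain ⟨z, hz, x, hx, hxz⟩ := hnear
      have h1 : 1 ≤ ∑ z ∈ Z, leakWeight F C d X z := by
        refine le_trans ?_ (Finset.single_le_sum (fun z _ => hq0 z) hz)
        refine (if_pos hxz).ge.trans (Finset.single_le_sum
          (f := fun x => if dist x z < d then (1 : ℝ) else F (dist x z) / C)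
          (fun x _ => ?_) hx)
        split_ifs
        exacts [zero_le_one, div_nonneg (hF _ dist_nonneg) hC.le]
      have h2 : ‖flow P s A‖ ≤ ‖A‖ := by
        simpa using ContinuousLinearMap.le_of_opNorm_le _ (hcontr _ hS s hs) A
      refine (ContinuousLinearMap.le_of_opNorm_le _ hlZ _).trans ?_
      refine (mul_le_mul_of_nonneg_left h2 (hw Z)).trans ?_
      have := le_mul_of_one_le_right (mul_nonneg (norm_nonneg A) (hw Z)) h1
      linarith
    · push Not at hnear
      have h1 := hLR Z (l Z) (w Z) hlZ (fun Z' hZ' => hcomm Z' (hS hZ') Z hZΛ)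
        (hA Z hZΛ) s hs
      have h2 := lrBound_damped_le hF hR hC hd (hu s hs) (hus s hst) X Z
        fun x hx z hz => hnear z hz x hx
      have h3 : ∑ z ∈ Z, ∑ x ∈ X, F (dist x z) * (min (Real.exp 1 * M * C * s) 1 / C)
          ≤ ∑ z ∈ Z, leakWeight F C d X z := by
        refine Finset.sum_le_sum fun z hz => Finset.sum_le_sum fun x hx => ?_
        rw [if_neg (not_lt.2 (hnear z hz x hx)), ← mul_div_assoc]
        exact div_le_div_of_nonneg_right
          (mul_le_of_le_one_right (hF _ dist_nonneg) (min_le_right _ _)) hC.le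
      have h4 := mul_le_mul_of_nonneg_left (h2.trans h3)
        (mul_nonneg (hw Z) (norm_nonneg A))
      linarith
  have hlong : ‖flow (P + Q) t A - flow P t A‖
      ≤ ‖A‖ * (X.card * (N + B₁ / C) * (M * B₂)) * t := by
    refine norm_flow_add_sub_flow_le (fun s hs => ?_) A ht fun s hs hst => ?_
    · rw [← hPQ]; exact hcontr _ subset_rfl s hs
    · rw [hQ, sum_apply]
      refine (norm_sum_le _ _).trans
        ((Finset.sum_le_sum fun Z hZ => hterm Z hZ s hs hst).trans ?_)
      rw [← Finset.mul_sum, sum_mul_sum_mem_eq _ Λ fun Z hZ =>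
        Finset.mem_powerset.1 (Finset.mem_sdiff.1 hZ).1]
      refine mul_le_mul_of_nonneg_left ?_ (norm_nonneg A)
      refine (Finset.sum_le_sum fun z _ => mul_le_mul_of_nonneg_left
        (sum_long_le hM Λ w hw z (hwM z) (hB₂ z)) (hq0 z)).trans ?_
      rw [← Finset.sum_mul]
      exact mul_le_mul_of_nonneg_right (sum_leakWeight_le hC X Λ hN hB₁)
        (mul_nonneg hM hB₂0)
  rw [hPQ]
  have e : k (flow (P + Q) t A) = k (flow P t A) + k (flow (P + Q) t A - flow P t A) := by
    rw [← map_add, add_sub_cancel]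
  rw [e]
  refine (norm_add_le _ _).trans ?_
  have h1 := (ContinuousLinearMap.le_of_opNorm_le _ hc
    (flow (P + Q) t A - flow P t A)).trans (mul_le_mul_of_nonneg_left hlong hc0)
  refine (add_le_add hshort h1).trans_eq ?_
  ring

end LiebRobinson

/-! ### The dynamics of a dissipative interaction -/

section Dynamics

variable {Γ : Type*} [DecidableEq Γ] {ι : Γ → Type*} [∀ x, Fintype (ι x)]

/-- The term `L_Z ⊗ id` of the generator of the volume `Λ` as a bounded operator
(zero unless `Z ⊆ Λ`). -/
def Interaction.localTerm (L : Interaction ι) (Λ Z : Finset Γ) :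
    LocalAlg ι Λ →L[ℂ] LocalAlg ι Λ :=
  if h : Z ⊆ Λ then LinearMap.toContinuousLinearMap (extend h (L.term Z)) else 0

theorem Interaction.localTerm_eq (L : Interaction ι) {Λ Z : Finset Γ} (h : Z ⊆ Λ) :
    L.localTerm Λ Z = LinearMap.toContinuousLinearMap (extend h (L.term Z)) := dif_pos h

theorem Interaction.toContinuousLinearMap_generator (L : Interaction ι) (Λ : Finset Γ) :
    LinearMap.toContinuousLinearMap (L.generator Λ) = ∑ Z ∈ Λ.powerset, L.localTerm Λ Z := by
  rw [Interaction.generator, map_sum, ← Finset.sum_attach Λ.powerset]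
  exact Finset.sum_congr rfl fun Z _ => (L.localTerm_eq (Finset.mem_powerset.1 Z.2)).symm

variable [∀ x, DecidableEq (ι x)]

theorem Interaction.dynamics_apply (L : Interaction ι) (Λ : Finset Γ) (t : ℝ)
    (B : LocalAlg ι Λ) :
    L.dynamics Λ t B = flow (∑ Z ∈ Λ.powerset, L.localTerm Λ Z) t B := by
  rw [← L.toContinuousLinearMap_generator]
  rfl

theorem Interaction.quasiContractive_localTerm (L : Interaction ι) {Λ Z : Finset Γ}
    (h : Z ⊆ Λ) : QuasiContractive (L.localTerm Λ Z) := by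
  rw [L.localTerm_eq h]
  exact ((L.lindblad Z).extend h).quasiContractive

theorem Interaction.norm_flow_sum_localTerm_le (L : Interaction ι) (Λ : Finset Γ)
    {S : Finset (Finset Γ)} (hS : S ⊆ Λ.powerset) {t : ℝ} (ht : 0 ≤ t) :
    ‖flow (∑ Z ∈ S, L.localTerm Λ Z) t‖ ≤ 1 :=
  (QuasiContractive.sum S fun _ hZ =>
    L.quasiContractive_localTerm (Finset.mem_powerset.1 (hS hZ))).norm_flow_le_one ht

theorem norm_toContinuousLinearMap_extend_le {Z Λ : Finset Γ} (h : Z ⊆ Λ)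
    {Φ : LocalAlg ι Z →ₗ[ℂ] LocalAlg ι Z} (hΦ : cbNorm Φ < ∞) :
    ‖LinearMap.toContinuousLinearMap (extend h Φ)‖ ≤ (cbNorm Φ).toReal :=
  ContinuousLinearMap.opNorm_le_bound _ ENNReal.toReal_nonneg fun M => norm_extend_le h hΦ M

theorem Interaction.commute_localTerm (L : Interaction ι) {Z Z' Λ : Finset Γ} (h : Z ⊆ Λ)
    (h' : Z' ⊆ Λ) (hd : Disjoint Z Z') (Ψ : LocalAlg ι Z' →ₗ[ℂ] LocalAlg ι Z') :
    Commute (L.localTerm Λ Z) (LinearMap.toContinuousLinearMap (extend h' Ψ)) := by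
  rw [L.localTerm_eq h]
  exact ContinuousLinearMap.ext fun M => extend_comm h h' hd (L.term Z) Ψ M

theorem Interaction.localTerm_embed (L : Interaction ι) {X Z Λ : Finset Γ} (hX : X ⊆ Λ)
    (h : Z ⊆ Λ) (hd : Disjoint X Z) (A : LocalAlg ι X) :
    L.localTerm Λ Z (embed hX A) = 0 := by
  rw [L.localTerm_eq h]
  exact extend_embed_eq_zero hX h hd (L.lindblad Z).map_one A

end Dynamics

/-! ### Choice of the scale and constants for power laws -/

theorem setDist_le {Γ : Type*} [MetricSpace Γ] {X Y : Finset Γ} {x y : Γ} (hx : x ∈ X)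
    (hy : y ∈ Y) : setDist X Y ≤ dist x y :=
  csInf_le ⟨0, by rintro r ⟨_, _, _, _, rfl⟩; exact dist_nonneg⟩ ⟨x, hx, y, hy, rfl⟩

/-- The infimum of the empty set is 0 by convention, so a positive distance excludes an empty X. -/
theorem nonempty_of_setDist_pos {Γ : Type*} [MetricSpace Γ] {X Y : Finset Γ}
    (h : 0 < setDist X Y) : X.Nonempty := by
  rw [Finset.nonempty_iff_ne_empty]
  rintro rfl
  simp [setDist] at h

/-- Subadditivity of r ↦ r^(1-δ) gives (1+d)^(1-δ) ≤ 2(1 + d^(1-δ)/2). -/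
theorem powerLaw_half_rpow_le {β δ d : ℝ} (hβ : 0 ≤ β) (hδ : 0 < δ) (hδ' : δ < 1)
    (hd : 0 ≤ d) :
    powerLaw β (d ^ (1 - δ) / 2) ≤ 2 ^ β * (1 / (1 + d) ^ ((1 - δ) * β)) := by
  have h1 : (1 + d) ^ (1 - δ) ≤ 1 + d ^ (1 - δ) := by
    simpa using Real.rpow_add_le_add_rpow zero_le_one hd (by linarith : 0 ≤ 1 - δ)
      (by linarith)
  have h2 : (0 : ℝ) ≤ d ^ (1 - δ) := Real.rpow_nonneg hd _
  have h3 : (0 : ℝ) < (1 + d) ^ (1 - δ) := by positivity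
  unfold powerLaw
  rw [mul_one_div, Real.rpow_mul (by positivity), div_le_div_iff₀ (by positivity)
    (by positivity), one_mul, ← Real.mul_rpow (by positivity) (by positivity)]
  exact Real.rpow_le_rpow h3.le (by linarith) hβ

theorem truncation_constant_le {κ ν β δ d S C M : ℝ} (hκ : 0 < κ) (hν : 0 < ν) (hβ : 0 ≤ β)
    (hδ : 0 < δ) (hδ' : δ < 1) (hd : 0 ≤ d) (hS : 0 ≤ S) (hC : 0 < C) (hM : 0 ≤ M) :
    M * (Real.exp 1 * (κ * S * powerLaw β d) + κ * S * powerLaw β (d ^ (1 - δ) / 2)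
        * (κ * (1 + d) ^ ν + κ * S * powerLaw β d / C))
      ≤ κ * S * M * (Real.exp 1 + κ * 2 ^ (2 * β) * 2 ^ (1 - δ) * ((S + C) / C))
        * (1 / (1 + d) ^ ((1 - δ) * β - ν)) := by
  have hd1 : 1 ≤ 1 + d := by linarith
  set D := 1 / (1 + d) ^ ((1 - δ) * β - ν) with hD
  have hDpos : 0 < D := by positivity
  have hp1 : powerLaw β d ≤ D := by
    refine one_div_le_one_div_of_le (by positivity) (Real.rpow_le_rpow_of_exponent_le hd1 ?_)
    nlinarith
  have hp2 : powerLaw β d ≤ (1 + d) ^ ν := by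
    have h1 : powerLaw β d ≤ 1 := by
      unfold powerLaw
      exact div_le_one_of_le₀ (Real.one_le_rpow hd1 hβ) (by positivity)
    exact h1.trans (Real.one_le_rpow hd1 hν.le)
  have hp3 := powerLaw_half_rpow_le hβ hδ hδ' hd
  have hp4 : 1 / (1 + d) ^ ((1 - δ) * β) * (1 + d) ^ ν = D := by
    rw [hD, Real.rpow_sub (by positivity)]
    field_simp
  -- The argument only produces 2^β; the constant in the theorem is larger.
  have hp5 : (2 : ℝ) ^ β ≤ 2 ^ (2 * β) * 2 ^ (1 - δ) := by
    rw [← Real.rpow_add two_pos]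
    exact Real.rpow_le_rpow_of_exponent_le one_le_two (by linarith)
  have hSC : 0 ≤ (S + C) / C := by positivity
  have h1 : κ * (1 + d) ^ ν + κ * S * powerLaw β d / C
      ≤ κ * ((S + C) / C) * (1 + d) ^ ν := by
    have : κ * S * powerLaw β d / C ≤ κ * S * (1 + d) ^ ν / C := by gcongr
    refine (add_le_add_right this _).trans_eq ?_
    field_simp
    ring
  have h2 : κ * S * powerLaw β (d ^ (1 - δ) / 2)
        * (κ * (1 + d) ^ ν + κ * S * powerLaw β d / C)
      ≤ κ * S * (κ * 2 ^ (2 * β) * 2 ^ (1 - δ) * ((S + C) / C)) * D := by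
    calc _ ≤ κ * S * (2 ^ β * (1 / (1 + d) ^ ((1 - δ) * β)))
          * (κ * ((S + C) / C) * (1 + d) ^ ν) := by
          have := (powerLaw_pos β hd).le
          gcongr
      _ = κ * S * κ * ((S + C) / C) * 2 ^ β
          * (1 / (1 + d) ^ ((1 - δ) * β) * (1 + d) ^ ν) := by ring
      _ ≤ κ * S * κ * ((S + C) / C) * (2 ^ (2 * β) * 2 ^ (1 - δ)) * D := by
          rw [hp4]; gcongr
      _ = _ := by ring
  have h3 : Real.exp 1 * (κ * S * powerLaw β d) ≤ Real.exp 1 * (κ * S * D) := by gcongr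
  refine (mul_le_mul_of_nonneg_left (add_le_add h3 h2) hM).trans_eq ?_
  ring

/-- The propagation estimate for an interaction with power-law decay. -/
theorem norm_extend_dynamics_embed_le {Γ : Type*} [MetricSpace Γ] [DecidableEq Γ]
    {ι : Γ → Type*} [∀ x, Fintype (ι x)] [∀ x, DecidableEq (ι x)]
    {κ ν ε β δ : ℝ} (hκ : 0 < κ) (hν : 0 < ν) (hΓ : IsRegular Γ κ ν) (hε : 0 < ε) (hβ : 0 ≤ β)
    (hδ : 0 < δ) (hδ' : δ < 1) {F : ℝ → ℝ} (hF : F = powerLaw (β + (ν + (1 + ε))))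
    (L : Interaction ι) (hL : L.fNorm F < ∞)
    {X Y Λ : Finset Γ} (hXY : Disjoint X Y) (hX : X ⊆ Λ) (hY : Y ⊆ Λ)
    (A : LocalAlg ι X) {K : LocalAlg ι Y →ₗ[ℂ] LocalAlg ι Y} (hK : IsCB0 K)
    (hd : 1 ≤ setDist X Y) {t : ℝ} (ht : 0 ≤ t)
    (hvt : Real.exp 1 * ((L.fNorm F).toReal * (convConst Γ F).toReal) * t
      ≤ setDist X Y ^ δ) :
    ‖extend hY K (L.dynamics Λ t (embed hX A))‖
      ≤ (κ * (∑' n : ℕ, 1 / (1 + (n : ℝ)) ^ (1 + ε)) * (L.fNorm F).toReal *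
          (Real.exp 1 + κ * (2 : ℝ) ^ (2 * β) * (2 : ℝ) ^ (1 - δ) *
            (((∑' n : ℕ, 1 / (1 + (n : ℝ)) ^ (1 + ε)) + (convConst Γ F).toReal)
              / (convConst Γ F).toReal))) *
        (cbNorm K).toReal * ‖A‖ * (X.card : ℝ) *
        (t / (1 + setDist X Y) ^ ((1 - δ) * β - ν)) := by
  set S := ∑' n : ℕ, 1 / (1 + (n : ℝ)) ^ (1 + ε) with hS
  set d := setDist X Y with hdd
  set M := (L.fNorm F).toReal with hM
  set C := (convConst Γ F).toReal with hC
  -- A point of Γ is needed for the convolution constant to be positive.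
  obtain ⟨x₀, -⟩ := nonempty_of_setDist_pos (zero_lt_one.trans_le hd)
  have hd0 : 0 < d := zero_lt_one.trans_le hd
  have hFpos : ∀ r, 0 ≤ r → 0 < F r := fun r hr => hF ▸ powerLaw_pos _ hr
  have hM0 : 0 ≤ M := ENNReal.toReal_nonneg
  have hconv : convConst Γ F < ∞ := hF ▸ hΓ.convConst_powerLaw_lt_top hκ hν hε hβ
  have hC0 : 0 < C := convConst_toReal_pos F hFpos hconv x₀
  have hS0 : 0 ≤ S := tsum_nonneg fun n => by positivity
  have hR : 0 < d ^ (1 - δ) := Real.rpow_pos_of_pos hd0 _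
  -- With R = d^(1-δ) the smallness condition of the truncation estimate becomes the assumption on
  -- t.
  have hdR : d / d ^ (1 - δ) = d ^ δ := by
    nth_rewrite 1 [← Real.rpow_one d]
    rw [← Real.rpow_sub hd0]
    congr 1
    ring
  have hmain := norm_apply_flow_le_of_truncation Λ (L.localTerm Λ)
    (fun Z => (cbNorm (L.term Z)).toReal) (fun Z => ENNReal.toReal_nonneg)
    (fun Z hZ hne => by
      rw [L.localTerm_eq (Finset.mem_powerset.1 hZ)]
      exact norm_toContinuousLinearMap_extend_le _ (L.cbNorm_term_lt_top F hFpos hL hne))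
    (fun S' hS' t ht => L.norm_flow_sum_localTerm_le Λ hS' ht)
    (fun Z hZ Z' hZ' hd => by
      rw [L.localTerm_eq (Finset.mem_powerset.1 hZ')]
      exact L.commute_localTerm (Finset.mem_powerset.1 hZ) _ hd _)
    (fun r hr => (hFpos r hr).le) hM0 hC0
    (fun y z T hT => L.sum_cbNorm_toReal_le F hFpos hL y z T hT)
    (fun x y => sum_mul_le_convConst F hFpos hconv x y Λ)
    X (embed hX A) (fun Z hZ hd => L.localTerm_embed hX (Finset.mem_powerset.1 hZ) hd A)
    Y (LinearMap.toContinuousLinearMap (extend hY K))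
    (norm_toContinuousLinearMap_extend_le hY hK.1)
    (fun Z hZ hd => L.commute_localTerm (Finset.mem_powerset.1 hZ) hY hd K)
    (extend_embed_eq_zero hX hY hXY hK.2 A) (R := d ^ (1 - δ)) (d := d) (t := t)
    (N := κ * (1 + d) ^ ν) (B₁ := κ * S * powerLaw β d)
    (B₂ := κ * S * powerLaw β (d ^ (1 - δ) / 2)) hR hd0
    (fun x hx y hy => setDist_le hx hy)
    (fun x s hs => by
      refine (hΓ.card_filter_le x ⌊d⌋₊ s fun y hy =>
        (hs y hy).le.trans (Nat.lt_floor_add_one d).le).trans ?_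
      have h1 : (⌊d⌋₊ : ℝ) + 1 ≤ 1 + d := by linarith [Nat.floor_le hd0.le]
      exact mul_le_mul_of_nonneg_left (Real.rpow_le_rpow (by positivity) h1 hν.le) hκ.le)
    (fun x s hs => hF ▸ hΓ.sum_powerLaw_tail_le hκ hν hε hβ hd0.le x s hs)
    (fun x s hs => hF ▸ hΓ.sum_powerLaw_tail_le hκ hν hε hβ (by positivity) x s hs)
    (mul_nonneg (mul_nonneg hκ.le hS0) (powerLaw_pos _ (by positivity)).le) ht
    (by rw [hdR]; linarith)
  rw [← L.dynamics_apply] at hmain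
  refine hmain.trans ?_
  have h1 := truncation_constant_le hκ hν hβ hδ hδ' hd0.le hS0 hC0 hM0
  have h2 := norm_embed_le hX A
  have hc0 : 0 ≤ (cbNorm K).toReal := ENNReal.toReal_nonneg
  have hcard : (0 : ℝ) ≤ X.card := Nat.cast_nonneg _
  have hq := (powerLaw_pos β hd0.le).le
  have hq' := (powerLaw_pos β (show 0 ≤ d ^ (1 - δ) / 2 by positivity)).le
  have h3 := mul_le_mul_of_nonneg_right h1 (mul_nonneg hcard ht)
  have h4 : 0 ≤ (X.card : ℝ) * (M * t * (Real.exp 1 * (κ * S * powerLaw β d)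
      + κ * S * powerLaw β (d ^ (1 - δ) / 2)
        * (κ * (1 + d) ^ ν + κ * S * powerLaw β d / C))) := by positivity
  calc _ ≤ (cbNorm K).toReal * (‖A‖ * ((X.card : ℝ) * (M * t * (Real.exp 1
          * (κ * S * powerLaw β d) + κ * S * powerLaw β (d ^ (1 - δ) / 2)
        * (κ * (1 + d) ^ ν + κ * S * powerLaw β d / C))))) :=
        mul_le_mul_of_nonneg_left (mul_le_mul_of_nonneg_right h2 h4) hc0
    _ = (cbNorm K).toReal * ‖A‖ * (M * (Real.exp 1 * (κ * S * powerLaw β d)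
        + κ * S * powerLaw β (d ^ (1 - δ) / 2)
        * (κ * (1 + d) ^ ν + κ * S * powerLaw β d / C)) * (X.card * t)) := by ring
    _ ≤ _ := mul_le_mul_of_nonneg_left h3 (mul_nonneg hc0 (norm_nonneg A))
    _ = _ := by ring

end LRB

end

theorem theorem2p6
    {Γ : Type*} [MetricSpace Γ] [Countable Γ] [DecidableEq Γ]
    {ι : Γ → Type*} [∀ x, Fintype (ι x)] [∀ x, DecidableEq (ι x)] [∀ x, Nonempty (ι x)]
    (κ ν : ℝ) (hκ : 0 < κ) (hν : 0 < ν) (hΓ : LRB.IsRegular Γ κ ν)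
    (α : ℝ) (hα : 2 * ν + 1 < α)
    (L : LRB.Interaction ι) (hL : L.fNorm (LRB.powerLaw α) < ∞)
    (ε : ℝ) (hε : 0 < ε) (hε' : ε < α - 2 * ν - 1)
    (αε : ℝ) (hαε : αε = α - ν - 1 - ε)
    (δ : ℝ) (hδ : 0 < δ) (hδ' : δ < 1) (hδα : ν < (1 - δ) * αε)
    (CF normL v Cε : ℝ)
    (hCF : CF = (LRB.convConst Γ (LRB.powerLaw α)).toReal)
    (hnormL : normL = (L.fNorm (LRB.powerLaw α)).toReal)
    (hv : v = normL * CF)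
    (hCε : Cε = ∑' n : ℕ, 1 / (1 + (n : ℝ)) ^ (1 + ε))
    (X Y Λ : Finset Γ) (hXY : Disjoint X Y) (hX : X ⊆ Λ) (hY : Y ⊆ Λ)
    (A : LRB.LocalAlg ι X) (K : LRB.LocalAlg ι Y →ₗ[ℂ] LRB.LocalAlg ι Y) (hK : LRB.IsCB0 K)
    (d : ℝ) (hd : d = LRB.setDist X Y) (hd1 : 1 ≤ d) :
    (∃ C : ℝ, 0 < C ∧ ∀ t : ℝ, 0 ≤ t → Real.exp 1 * v * t ≤ d ^ δ →
      ‖LRB.extend hY K (L.dynamics Λ t (LRB.embed hX A))‖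
        ≤ C * (LRB.cbNorm K).toReal * ‖A‖ * (X.card : ℝ) *
          (t / (1 + d) ^ ((1 - δ) * αε - ν))) ∧
    (∀ t : ℝ, 0 ≤ t → Real.exp 1 * v * t ≤ d ^ δ →
      ‖LRB.extend hY K (L.dynamics Λ t (LRB.embed hX A))‖
        ≤ (κ * Cε * normL *
            (Real.exp 1 + κ * (2 : ℝ) ^ (2 * αε) * (2 : ℝ) ^ (1 - δ) * ((Cε + CF) / CF))) *
          (LRB.cbNorm K).toReal * ‖A‖ * (X.card : ℝ) *
          (t / (1 + d) ^ ((1 - δ) * αε - ν))) := by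
  obtain ⟨rfl⟩ : α = αε + (ν + (1 + ε)) := by linarith
  have hαε0 : 0 ≤ αε := by linarith
  subst hCF hnormL hv hCε hd
  have key := fun (t : ℝ) (ht : 0 ≤ t) hvt =>
    LRB.norm_extend_dynamics_embed_le (t := t) hκ hν hΓ hε hαε0 hδ hδ' rfl L hL hXY hX hY A hK
      hd1 ht hvt
  refine ⟨?_, key⟩
  obtain ⟨D, hD⟩ : ∃ D : ℝ, ∀ t : ℝ, 0 ≤ t →
      Real.exp 1 * ((L.fNorm (LRB.powerLaw (αε + (ν + (1 + ε))))).toReal *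
        (LRB.convConst Γ (LRB.powerLaw (αε + (ν + (1 + ε))))).toReal) * t
          ≤ LRB.setDist X Y ^ δ →
      ‖LRB.extend hY K (L.dynamics Λ t (LRB.embed hX A))‖
        ≤ D * (LRB.cbNorm K).toReal * ‖A‖ * (X.card : ℝ) *
          (t / (1 + LRB.setDist X Y) ^ ((1 - δ) * αε - ν)) := ⟨_, key⟩
  -- The explicit constant vanishes when the interaction has norm 0, so it is raised to at least 1
  -- to be positive.
  refine ⟨max 1 D, zero_lt_one.trans_le (le_max_left 1 D), fun t ht hvt =>
    (hD t ht hvt).trans ?_⟩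
  exact mul_le_mul_of_nonneg_right (mul_le_mul_of_nonneg_right (mul_le_mul_of_nonneg_right
    (mul_le_mul_of_nonneg_right (le_max_right 1 D) ENNReal.toReal_nonneg) (norm_nonneg A))
    (Nat.cast_nonneg _)) (div_nonneg ht (Real.rpow_nonneg (by linarith) _))
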